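/- Let $G$ be a group acting by automorphisms on an abelian group $A$, where $G$, $A$ and the action are $\emptyset$-definable in a first order structure $\mathcal G$. Let $h\colon G\times G\to A$ be a 2-cocycle, i.e. $h(x,y)+h(xy,z)=h(x,yz)+x\cdot h(y,z)$ and $h(x,e)=h(e,x)=0$ for all $x,y,z\in G$, and suppose that $h$ is definable over a finite set $B\subset\mathcal G$, and that its image is finite and contained in $\mathrm{dcl}(B)$. Let $A_0\le A$ be the subgroup generated by the image of $h$; it is closed under the action of $G$. Let $\mathcal G^*\succ\mathcal G$ be a monster model, let $G^*$, $A^*$, $h^*$ be the interpretations of $G$, $A$, $h$ in $\mathcal G^*$, and let $\widetilde{G^*}$ be the group $A^*\times G^*$ with the multiplication $(a_1,g_1)(a_2,g_2)=(a_1+g_1\cdot a_2+h^*(g_1,g_2),\,g_1g_2)$. For a group $\Gamma$ definable in $\mathcal G^*$ over $B$, let $\Gamma^{00}_B$ (respectively $\Gamma^{000}_B$) be its smallest subgroup of bounded index that is type-definable over $B$ (respectively invariant under $\mathrm{Aut}(\mathcal G^*/B)$). A 2-cocycle $c\colon G\times G\to C$ with values in an abelian group $C$ on which $G$ acts is called split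 if there is a function $f\colon G\to C$ with $f(e)=0$ and $c(x,y)=f(x)+x\cdot f(y)-f(xy)$ for all $x,y\in G$; otherwise it is non-split. Let $A_1^*$ be a subgroup of $A^*$ of bounded index which is type-definable over $B$ and invariant under the action of $G^*$. Assume that: 1. the 2-cocycle $h\colon G\times G\to A_0$ is non-split (so no $f$ with values in $A_0$ splits it); 2. $A_1^*\cap A_0$ is trivial and $A_0$ is torsion free (equivalently, as $A_0$ is finitely generated, $A_0\cong\mathbb Z^n$ for some $n$); 3. $(G^*)^{00}_B=G^*$. Then $\widetilde{G^*}^{000}_B\neq\widetilde{G^*}^{00}_B$. Suppose furthermore that $(G^*)^{000}_B=G^*$ and: 4. (strong non-splitness of $h$) for every proper subgroup $Z\lneq A_0$ the induced 2-cocycle $\overline h\colon G\times G\to A_0/Z$ is non-split (under the assumptions above, every subgroup $Z$ of $A_0$ is invariant under the action of $G$, so that $\overline h$ makes sense); 5. (denseness of $A_0$ in $A^*$) if $H\le A^*$ is a subgroup of bounded index which is type-definable over $B$ and contains $A_0$, then $H=A^*$. Then $\widetilde{G^*}^{00}_B=\widetilde{G^*}$. -/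

import Mathlib

open FirstOrder FirstOrder.Language Set

universe u v w w'

namespace ConnComp

/-! ### Elementary extensions preserve laws -/

section Transfer

variable {L : FirstOrder.Language.{u, v}} {M : Type w} {N : Type w'} [L.Structure M] [L.Structure N]

theorem forall_transfer (j : M ↪ₑ[L] N) {α β : Type} [Finite α] (b : β → M)
    (ψ : L.Formula (β ⊕ α)) (h : ∀ v : α → M, ψ.Realize (Sum.elim b v)) :
    ∀ v : α → N, ψ.Realize (Sum.elim (j ∘ b) v) := by
  have h1 : (ψ.iAlls α).Realize b := Formula.realize_iAlls.2 h
  exact Formula.realize_iAlls.1 ((j.map_formula (ψ.iAlls α) b).2 h1)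

theorem exists_transfer (j : M ↪ₑ[L] N) {ξ η β : Type} [Finite ξ] [Finite η] (b : β → M)
    (X : L.Formula ξ) (F : L.Formula ((β ⊕ ξ) ⊕ η))
    (h : ∀ x : ξ → M, X.Realize x → ∃ y : η → M, F.Realize (Sum.elim (Sum.elim b x) y)) :
    ∀ x : ξ → N, X.Realize x →
      ∃ y : η → N, F.Realize (Sum.elim (Sum.elim (j ∘ b) x) y) := by
  have := forall_transfer j b ((X.relabel Sum.inr).imp (F.iExs η)) (by
    intro x
    rw [Formula.realize_imp, Formula.realize_iExs, Formula.realize_relabel, Sum.elim_comp_inr]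
    exact h x)
  intro x
  have := this x
  rwa [Formula.realize_imp, Formula.realize_iExs, Formula.realize_relabel,
    Sum.elim_comp_inr] at this

theorem existsUnique_transfer (j : M ↪ₑ[L] N) {ξ η β : Type} [Finite ξ] [Finite η] (b : β → M)
    (X : L.Formula ξ) (F : L.Formula ((β ⊕ ξ) ⊕ η))
    (h : ∀ x : ξ → M, X.Realize x → ∃! y : η → M, F.Realize (Sum.elim (Sum.elim b x) y)) :
    ∀ x : ξ → N, X.Realize x →
      ∃! y : η → N, F.Realize (Sum.elim (Sum.elim (j ∘ b) x) y) := by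
  have := forall_transfer j b ((X.relabel Sum.inr).imp (F.iExsUnique η)) (by
    intro x
    rw [Formula.realize_imp, Formula.realize_iExsUnique, Formula.realize_relabel,
      Sum.elim_comp_inr]
    exact h x)
  intro x
  have := this x
  rwa [Formula.realize_imp, Formula.realize_iExsUnique, Formula.realize_relabel,
    Sum.elim_comp_inr] at this

/-- A formula in three tuples of variables, evaluated at `x, y, z`. -/
def Holds₃ {a b c : ℕ} (φ : L.Formula (Fin a ⊕ Fin b ⊕ Fin c))
    (x : Fin a → N) (y : Fin b → N) (z : Fin c → N) : Prop :=
  φ.Realize (Sum.elim x (Sum.elim y z))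

/-- A formula in four tuples of variables, evaluated at `p, x, y, z`. -/
def Holds₄ {r a b c : ℕ} (φ : L.Formula (Fin r ⊕ Fin a ⊕ Fin b ⊕ Fin c)) (p : Fin r → N)
    (x : Fin a → N) (y : Fin b → N) (z : Fin c → N) : Prop :=
  φ.Realize (Sum.elim p (Sum.elim x (Sum.elim y z)))

theorem fun_transfer (j : M ↪ₑ[L] N) {r a c d : ℕ} (p : Fin r → M)
    (X : L.Formula (Fin a)) (Y : L.Formula (Fin c)) (Z : L.Formula (Fin d))
    (F : L.Formula (Fin r ⊕ Fin a ⊕ Fin c ⊕ Fin d))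
    (f : {x : Fin a → M // X.Realize x} → {x : Fin c → M // Y.Realize x} →
      {x : Fin d → M // Z.Realize x})
    (hf : ∀ x y z, Holds₄ F p x.1 y.1 z.1 ↔ f x y = z) :
    ∃ g : {x : Fin a → N // X.Realize x} → {x : Fin c → N // Y.Realize x} →
      {x : Fin d → N // Z.Realize x},
      ∀ x y z, Holds₄ F (j ∘ p) x.1 y.1 z.1 ↔ g x y = z := by
  have key := existsUnique_transfer j p
    (X.relabel Sum.inl ⊓ Y.relabel Sum.inr : L.Formula (Fin a ⊕ Fin c))
    (Z.relabel Sum.inr ⊓ F.relabel (Sum.elim (fun i => Sum.inl (Sum.inl i))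
        (Sum.elim (fun i => Sum.inl (Sum.inr (Sum.inl i)))
          (Sum.elim (fun i => Sum.inl (Sum.inr (Sum.inr i))) Sum.inr))) :
      L.Formula ((Fin r ⊕ (Fin a ⊕ Fin c)) ⊕ Fin d))
    (by
      intro v hv
      rw [Formula.realize_inf, Formula.realize_relabel, Formula.realize_relabel] at hv
      refine ⟨(f ⟨_, hv.1⟩ ⟨_, hv.2⟩).1, ?_, ?_⟩
      · dsimp only
        rw [Formula.realize_inf, Formula.realize_relabel, Formula.realize_relabel]
        refine ⟨(f ⟨_, hv.1⟩ ⟨_, hv.2⟩).2, ?_⟩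
        convert (hf ⟨_, hv.1⟩ ⟨_, hv.2⟩ _).2 rfl using 1
        unfold Holds₄
        congr! 1
        funext s
        rcases s with s | s | s | s <;> rfl
      · intro y hy
        rw [Formula.realize_inf, Formula.realize_relabel, Formula.realize_relabel] at hy
        have := (hf ⟨_, hv.1⟩ ⟨_, hv.2⟩ ⟨y, hy.1⟩).1 (by
          convert hy.2 using 1
          unfold Holds₄
          congr! 1
          funext s
          rcases s with s | s | s | s <;> rfl)
        rw [this])
  have key2 : ∀ (x : {x : Fin a → N // X.Realize x}) (y : {x : Fin c → N // Y.Realize x}),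
      ∃! z : {x : Fin d → N // Z.Realize x}, Holds₄ F (j ∘ p) x.1 y.1 z.1 := by
    intro x y
    obtain ⟨z, hz, hz2⟩ := key (Sum.elim x.1 y.1) (by
      rw [Formula.realize_inf, Formula.realize_relabel, Formula.realize_relabel]
      exact ⟨x.2, y.2⟩)
    dsimp only at hz hz2
    rw [Formula.realize_inf, Formula.realize_relabel, Formula.realize_relabel] at hz
    refine ⟨⟨z, hz.1⟩, ?_, ?_⟩
    · dsimp only
      convert hz.2 using 1
      unfold Holds₄
      congr! 1
      funext s
      rcases s with s | s | s | s <;> rfl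
    · intro z' hz'
      apply Subtype.ext
      apply hz2
      rw [Formula.realize_inf, Formula.realize_relabel, Formula.realize_relabel]
      refine ⟨z'.2, ?_⟩
      convert hz' using 1
      unfold Holds₄
      congr! 1
      funext s
      rcases s with s | s | s | s <;> rfl
  refine ⟨fun x y => (key2 x y).choose, fun x y z => ⟨fun hz => ?_, ?_⟩⟩
  · exact ((key2 x y).choose_spec.2 z hz).symm
  · rintro rfl
    exact (key2 x y).choose_spec.1

theorem holds₃_iff {r a b c : ℕ} (φ : L.Formula (Fin a ⊕ Fin b ⊕ Fin c)) (p : Fin r → N)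
    (x : Fin a → N) (y : Fin b → N) (z : Fin c → N) :
    Holds₄ (φ.relabel Sum.inr) p x y z ↔ Holds₃ φ x y z := by
  unfold Holds₄ Holds₃
  rw [Formula.realize_relabel, Sum.elim_comp_inr]

theorem fun_transfer₃ (j : M ↪ₑ[L] N) {a c d : ℕ}
    (X : L.Formula (Fin a)) (Y : L.Formula (Fin c)) (Z : L.Formula (Fin d))
    (F : L.Formula (Fin a ⊕ Fin c ⊕ Fin d))
    (f : {x : Fin a → M // X.Realize x} → {x : Fin c → M // Y.Realize x} →
      {x : Fin d → M // Z.Realize x})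
    (hf : ∀ x y z, Holds₃ F x.1 y.1 z.1 ↔ f x y = z) :
    ∃ g : {x : Fin a → N // X.Realize x} → {x : Fin c → N // Y.Realize x} →
      {x : Fin d → N // Z.Realize x},
      ∀ x y z, Holds₃ F x.1 y.1 z.1 ↔ g x y = z := by
  obtain ⟨g, hg⟩ := fun_transfer j (Fin.elim0 : Fin 0 → M) X Y Z (F.relabel Sum.inr) f
    (fun x y z => by rw [holds₃_iff]; exact hf x y z)
  exact ⟨g, fun x y z => by rw [← hg, holds₃_iff]⟩

end Transfer

/-! ### The definable data -/

/-- Formulas without parameters for a group `G` (with underlying set a set of `m`-tuples), an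
abelian group `A` (a set of `k`-tuples) and an action of `G` on `A`, together with a formula,
with `r` parameter variables, for the graph of a function `G × G → A`. -/
structure Formulas (L : FirstOrder.Language.{u, v}) (m k r : ℕ) where
  grp : L.Formula (Fin m)
  mul : L.Formula (Fin m ⊕ Fin m ⊕ Fin m)
  ab : L.Formula (Fin k)
  add : L.Formula (Fin k ⊕ Fin k ⊕ Fin k)
  act : L.Formula (Fin m ⊕ Fin k ⊕ Fin k)
  coc : L.Formula (Fin r ⊕ Fin m ⊕ Fin m ⊕ Fin k)

variable {L : FirstOrder.Language.{u, v}} {M : Type w} {N : Type w'} [L.Structure M] [L.Structure N]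
variable {m k r : ℕ}

/-- The underlying set of `G` in the structure `N`. -/
abbrev Formulas.Grp (D : Formulas L m k r) (N : Type w') [L.Structure N] : Type w' :=
  {x : Fin m → N // D.grp.Realize x}

/-- The underlying set of `A` in the structure `N`. -/
abbrev Formulas.Ab (D : Formulas L m k r) (N : Type w') [L.Structure N] : Type w' :=
  {x : Fin k → N // D.ab.Realize x}

/-- In the structure `N`, with parameters `b`, the formulas `D` define a group `G` acting by
automorphisms on an abelian group `A`, and a (normalised) 2-cocycle `h : G × G → A`. All the
operations are determined by the formulas. -/
structure Interp (D : Formulas L m k r) (N : Type w') [L.Structure N] (b : Fin r → N) where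
  group : Group (D.Grp N)
  addCommGroup : AddCommGroup (D.Ab N)
  action : DistribMulAction (D.Grp N) (D.Ab N)
  h : D.Grp N → D.Grp N → D.Ab N
  mul_iff : ∀ x y z : D.Grp N, Holds₃ D.mul x.1 y.1 z.1 ↔ x * y = z
  add_iff : ∀ x y z : D.Ab N, Holds₃ D.add x.1 y.1 z.1 ↔ x + y = z
  act_iff : ∀ (g : D.Grp N) (x y : D.Ab N), Holds₃ D.act g.1 x.1 y.1 ↔ g • x = y
  coc_iff : ∀ (x y : D.Grp N) (z : D.Ab N), Holds₄ D.coc b x.1 y.1 z.1 ↔ h x y = z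
  cocycle : ∀ x y z : D.Grp N, h x y + h (x * y) z = h x (y * z) + x • h y z
  h_one_right : ∀ x : D.Grp N, h x 1 = 0
  h_one_left : ∀ x : D.Grp N, h 1 x = 0

section Laws

/-- Variables: eight elements of `G` and eight elements of `A`. -/
abbrev Vars (m k : ℕ) : Type := (Fin 8 × Fin m) ⊕ (Fin 8 × Fin k)

variable (D : Formulas L m k r)

/-- The `G`-elements of a valuation. -/
def vG (e : Vars m k → N) (p : Fin 8) : Fin m → N := fun i => e (Sum.inl (p, i))

/-- The `A`-elements of a valuation. -/
def vA (e : Vars m k → N) (p : Fin 8) : Fin k → N := fun i => e (Sum.inr (p, i))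

/-- The valuation with prescribed elements. -/
def mkV (x : Fin 8 → Fin m → N) (y : Fin 8 → Fin k → N) : Vars m k → N :=
  Sum.elim (fun p => x p.1 p.2) (fun p => y p.1 p.2)

/-- Atomic facts about eight elements of `G` and eight elements of `A`. -/
inductive Atom where
  | g (p : Fin 8)
  | a (p : Fin 8)
  | mul (p q s : Fin 8)
  | add (p q s : Fin 8)
  | act (p q s : Fin 8)
  | coc (p q s : Fin 8)

/-- The meaning of an atomic fact. -/
def Atom.Holds (b : Fin r → N) (e : Vars m k → N) : Atom → Prop
  | .g p => D.grp.Realize (vG e p)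
  | .a p => D.ab.Realize (vA e p)
  | .mul p q s => Holds₃ D.mul (vG e p) (vG e q) (vG e s)
  | .add p q s => Holds₃ D.add (vA e p) (vA e q) (vA e s)
  | .act p q s => Holds₃ D.act (vG e p) (vA e q) (vA e s)
  | .coc p q s => Holds₄ D.coc b (vG e p) (vG e q) (vA e s)

/-- The formula of an atomic fact. -/
def Atom.formula : Atom → L.Formula (Fin r ⊕ Vars m k)
  | .g p => D.grp.relabel (fun i => Sum.inr (Sum.inl (p, i)))
  | .a p => D.ab.relabel (fun i => Sum.inr (Sum.inr (p, i)))
  | .mul p q s => D.mul.relabel (Sum.elim (fun i => Sum.inr (Sum.inl (p, i)))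
      (Sum.elim (fun i => Sum.inr (Sum.inl (q, i))) (fun i => Sum.inr (Sum.inl (s, i)))))
  | .add p q s => D.add.relabel (Sum.elim (fun i => Sum.inr (Sum.inr (p, i)))
      (Sum.elim (fun i => Sum.inr (Sum.inr (q, i))) (fun i => Sum.inr (Sum.inr (s, i)))))
  | .act p q s => D.act.relabel (Sum.elim (fun i => Sum.inr (Sum.inl (p, i)))
      (Sum.elim (fun i => Sum.inr (Sum.inr (q, i))) (fun i => Sum.inr (Sum.inr (s, i)))))
  | .coc p q s => D.coc.relabel (Sum.elim Sum.inl (Sum.elim (fun i => Sum.inr (Sum.inl (p, i)))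
      (Sum.elim (fun i => Sum.inr (Sum.inl (q, i))) (fun i => Sum.inr (Sum.inr (s, i))))))

theorem Atom.realize_formula (b : Fin r → N) (e : Vars m k → N) (t : Atom) :
    (t.formula D).Realize (Sum.elim b e) ↔ t.Holds D b e := by
  cases t
  all_goals
    simp only [Atom.formula, Atom.Holds, Formula.realize_relabel, Holds₃, Holds₄]
    apply iff_of_eq
    congr 1
  all_goals
    funext s
    first
      | rfl
      | (rcases s with s | s | s <;> rfl)
      | (rcases s with s | s | s | s <;> rfl)

theorem law_transfer (j : M ↪ₑ[L] N) (b : Fin r → M) (hyp : List Atom) (t : Atom)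
    (H : ∀ e : Vars m k → M, (∀ s ∈ hyp, s.Holds D b e) → t.Holds D b e) :
    ∀ e : Vars m k → N, (∀ s ∈ hyp, s.Holds D (j ∘ b) e) → t.Holds D (j ∘ b) e := by
  let ψ : List Atom → L.Formula (Fin r ⊕ Vars m k) :=
    fun l => l.foldr (fun s φ => (s.formula D).imp φ) (t.formula D)
  have hM : ∀ (l : List Atom) (e : Vars m k → M),
      (ψ l).Realize (Sum.elim b e) ↔ ((∀ s ∈ l, s.Holds D b e) → t.Holds D b e) := by
    intro l e
    induction l with
    | nil => simp [ψ, Atom.realize_formula]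
    | cons s l ih =>
      have : ψ (s :: l) = (s.formula D).imp (ψ l) := rfl
      rw [this, Formula.realize_imp, ih, Atom.realize_formula]
      simp [and_imp]
  have hN : ∀ (l : List Atom) (e : Vars m k → N),
      (ψ l).Realize (Sum.elim (j ∘ b) e) ↔
        ((∀ s ∈ l, s.Holds D (j ∘ b) e) → t.Holds D (j ∘ b) e) := by
    intro l e
    induction l with
    | nil => simp [ψ, Atom.realize_formula]
    | cons s l ih =>
      have : ψ (s :: l) = (s.formula D).imp (ψ l) := rfl
      rw [this, Formula.realize_imp, ih, Atom.realize_formula]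
      simp [and_imp]
  intro e
  exact (hN hyp e).1 (forall_transfer j b (ψ hyp) (fun e => (hM hyp e).2 (H e)) e)

end Laws

section Extend

variable {D : Formulas L m k r} {b : Fin r → M}

theorem Interp.inv_transfer (j : M ↪ₑ[L] N) {a : ℕ} (X : L.Formula (Fin a))
    (F : L.Formula (Fin a ⊕ Fin a ⊕ Fin a)) (c : Fin a → M)
    (H : ∀ x : Fin a → M, X.Realize x → ∃ y : Fin a → M, X.Realize y ∧ Holds₃ F y x c) :
    ∀ x : Fin a → N, X.Realize x → ∃ y : Fin a → N, X.Realize y ∧ Holds₃ F y x (j ∘ c) := by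
  let F' : L.Formula ((Fin a ⊕ Fin a) ⊕ Fin a) :=
    X.relabel Sum.inr ⊓ F.relabel (Sum.elim Sum.inr
      (Sum.elim (fun i => Sum.inl (Sum.inr i)) (fun i => Sum.inl (Sum.inl i))))
  have hM : ∀ x y : Fin a → M, F'.Realize (Sum.elim (Sum.elim c x) y) ↔
      X.Realize y ∧ Holds₃ F y x c := by
    intro x y
    simp only [F', Formula.realize_inf, Formula.realize_relabel, Sum.elim_comp_inr, Holds₃]
    apply and_congr_right
    intro _
    apply iff_of_eq
    congr 1
    funext s
    rcases s with s | s | s <;> rfl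
  have hN : ∀ x y : Fin a → N, F'.Realize (Sum.elim (Sum.elim (j ∘ c) x) y) ↔
      X.Realize y ∧ Holds₃ F y x (j ∘ c) := by
    intro x y
    simp only [F', Formula.realize_inf, Formula.realize_relabel, Sum.elim_comp_inr, Holds₃]
    apply and_congr_right
    intro _
    apply iff_of_eq
    congr 1
    funext s
    rcases s with s | s | s <;> rfl
  intro x hx
  obtain ⟨y, hy⟩ := exists_transfer j c X F' (fun x hx => by
    obtain ⟨y, hy⟩ := H x hx
    exact ⟨y, (hM x y).2 hy⟩) x hx
  exact ⟨y, (hN x y).1 hy⟩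

theorem holds₃_map (j : M ↪ₑ[L] N) {a c d : ℕ} (φ : L.Formula (Fin a ⊕ Fin c ⊕ Fin d))
    (x : Fin a → M) (y : Fin c → M) (z : Fin d → M) (h : Holds₃ φ x y z) :
    Holds₃ φ (j ∘ x) (j ∘ y) (j ∘ z) := by
  unfold Holds₃ at *
  rw [← j.map_formula] at h
  convert h using 1
  funext s
  rcases s with s | s | s <;> rfl

/-- In an elementary extension the same formulas again define a group, an abelian group, an
action by automorphisms and a 2-cocycle. -/
theorem Interp.exists_extend (I : Interp D M b) (j : M ↪ₑ[L] N) :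
    Nonempty (Interp D N (j ∘ b)) := by
  let _ := I.group
  let _ := I.addCommGroup
  let _ := I.action
  obtain ⟨mulN, hmul⟩ := fun_transfer₃ j D.grp D.grp D.grp D.mul
    (fun x y => I.group.mul x y) I.mul_iff
  obtain ⟨addN, hadd⟩ := fun_transfer₃ j D.ab D.ab D.ab D.add
    (fun x y => I.addCommGroup.add x y) I.add_iff
  obtain ⟨actN, hact⟩ := fun_transfer₃ j D.grp D.ab D.ab D.act
    (fun x y => I.action.smul x y) I.act_iff
  obtain ⟨cocN, hcoc⟩ := fun_transfer j b D.grp D.grp D.ab D.coc I.h I.coc_iff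
  let oneM : D.Grp M := 1
  let zeroM : D.Ab M := 0
  let oneN : D.Grp N := ⟨j ∘ oneM.1, (j.map_formula _ _).2 oneM.2⟩
  let zeroN : D.Ab N := ⟨j ∘ zeroM.1, (j.map_formula _ _).2 zeroM.2⟩
  have one_one : Holds₃ D.mul oneN.1 oneN.1 oneN.1 :=
    holds₃_map j D.mul _ _ _ ((I.mul_iff oneM oneM oneM).2 (mul_one _))
  have zero_zero : Holds₃ D.add zeroN.1 zeroN.1 zeroN.1 :=
    holds₃_map j D.add _ _ _ ((I.add_iff zeroM zeroM zeroM).2 (add_zero _))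
  have hinv : ∀ x : D.Grp N, ∃ y : D.Grp N, mulN y x = oneN := by
    intro x
    obtain ⟨y, hy, hy2⟩ := Interp.inv_transfer j D.grp D.mul oneM.1 (fun x hx =>
      ⟨(⟨x, hx⟩ : D.Grp M)⁻¹.1, (⟨x, hx⟩ : D.Grp M)⁻¹.2,
        (I.mul_iff _ ⟨x, hx⟩ oneM).2 (inv_mul_cancel _)⟩) x.1 x.2
    exact ⟨⟨y, hy⟩, (hmul ⟨y, hy⟩ x oneN).1 hy2⟩
  have hneg : ∀ x : D.Ab N, ∃ y : D.Ab N, addN y x = zeroN := by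
    intro x
    obtain ⟨y, hy, hy2⟩ := Interp.inv_transfer j D.ab D.add zeroM.1 (fun x hx =>
      ⟨(-(⟨x, hx⟩ : D.Ab M)).1, (-(⟨x, hx⟩ : D.Ab M)).2,
        (I.add_iff _ ⟨x, hx⟩ zeroM).2 (neg_add_cancel _)⟩) x.1 x.2
    exact ⟨⟨y, hy⟩, (hadd ⟨y, hy⟩ x zeroN).1 hy2⟩
  choose invN hinv using hinv
  choose negN hneg using hneg
  have mul_assocN : ∀ x y z, mulN (mulN x y) z = mulN x (mulN y z) := by
    intro x y z
    have := law_transfer D j b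
      [.g 0, .g 1, .g 2, .g 3, .g 4, .g 5, .mul 0 1 3, .mul 3 2 4, .mul 1 2 5] (.mul 0 5 4) (by
        intro e he
        simp only [List.forall_mem_cons, List.not_mem_nil, false_imp_iff, implies_true, and_true,
          Atom.Holds] at he ⊢
        obtain ⟨h0, h1, h2, h3, h4, h5, a, c, d⟩ := he
        have a := (I.mul_iff ⟨_, h0⟩ ⟨_, h1⟩ ⟨_, h3⟩).1 a
        have c := (I.mul_iff ⟨_, h3⟩ ⟨_, h2⟩ ⟨_, h4⟩).1 c
        have d := (I.mul_iff ⟨_, h1⟩ ⟨_, h2⟩ ⟨_, h5⟩).1 d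
        exact (I.mul_iff ⟨_, h0⟩ ⟨_, h5⟩ ⟨_, h4⟩).2 (by rw [← c, ← a, ← d, mul_assoc]))
      (mkV ![x.1, y.1, z.1, (mulN x y).1, (mulN (mulN x y) z).1, (mulN y z).1, x.1, x.1]
        (fun _ => zeroN.1)) (by
        simp only [List.forall_mem_cons, List.not_mem_nil, false_imp_iff, implies_true, and_true,
          Atom.Holds]
        exact ⟨x.2, y.2, z.2, (mulN x y).2, (mulN (mulN x y) z).2, (mulN y z).2,
          (hmul _ _ _).2 rfl, (hmul _ _ _).2 rfl, (hmul _ _ _).2 rfl⟩)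
    exact ((hmul x (mulN y z) (mulN (mulN x y) z)).1 this).symm
  have one_mulN : ∀ x, mulN oneN x = x := by
    intro x
    have := law_transfer D j b
      [.g 0, .g 1, .mul 0 0 0] (.mul 0 1 1) (by
        intro e he
        simp only [List.forall_mem_cons, List.not_mem_nil, false_imp_iff, implies_true, and_true,
          Atom.Holds] at he ⊢
        obtain ⟨h0, h1, a⟩ := he
        have a := (I.mul_iff ⟨_, h0⟩ ⟨_, h0⟩ ⟨_, h0⟩).1 a
        exact (I.mul_iff ⟨_, h0⟩ ⟨_, h1⟩ ⟨_, h1⟩).2 (by rw [mul_eq_left.1 a, one_mul]))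
      (mkV ![oneN.1, x.1, x.1, x.1, x.1, x.1, x.1, x.1] (fun _ => zeroN.1)) (by
        simp only [List.forall_mem_cons, List.not_mem_nil, false_imp_iff, implies_true, and_true,
          Atom.Holds]
        exact ⟨oneN.2, x.2, one_one⟩)
    exact (hmul oneN x x).1 this
  have add_assocN : ∀ x y z, addN (addN x y) z = addN x (addN y z) := by
    intro x y z
    have := law_transfer D j b
      [.a 0, .a 1, .a 2, .a 3, .a 4, .a 5, .add 0 1 3, .add 3 2 4, .add 1 2 5] (.add 0 5 4) (by
        intro e he
        simp only [List.forall_mem_cons, List.not_mem_nil, false_imp_iff, implies_true, and_true,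
          Atom.Holds] at he ⊢
        obtain ⟨h0, h1, h2, h3, h4, h5, a, c, d⟩ := he
        have a := (I.add_iff ⟨_, h0⟩ ⟨_, h1⟩ ⟨_, h3⟩).1 a
        have c := (I.add_iff ⟨_, h3⟩ ⟨_, h2⟩ ⟨_, h4⟩).1 c
        have d := (I.add_iff ⟨_, h1⟩ ⟨_, h2⟩ ⟨_, h5⟩).1 d
        exact (I.add_iff ⟨_, h0⟩ ⟨_, h5⟩ ⟨_, h4⟩).2 (by rw [← c, ← a, ← d, add_assoc]))
      (mkV (fun _ => oneN.1)
        ![x.1, y.1, z.1, (addN x y).1, (addN (addN x y) z).1, (addN y z).1, x.1, x.1]) (by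
        simp only [List.forall_mem_cons, List.not_mem_nil, false_imp_iff, implies_true, and_true,
          Atom.Holds]
        exact ⟨x.2, y.2, z.2, (addN x y).2, (addN (addN x y) z).2, (addN y z).2,
          (hadd _ _ _).2 rfl, (hadd _ _ _).2 rfl, (hadd _ _ _).2 rfl⟩)
    exact ((hadd x (addN y z) (addN (addN x y) z)).1 this).symm
  have add_commN : ∀ x y, addN x y = addN y x := by
    intro x y
    have := law_transfer D j b
      [.a 0, .a 1, .a 2, .add 0 1 2] (.add 1 0 2) (by
        intro e he
        simp only [List.forall_mem_cons, List.not_mem_nil, false_imp_iff, implies_true, and_true,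
          Atom.Holds] at he ⊢
        obtain ⟨h0, h1, h2, a⟩ := he
        have a := (I.add_iff ⟨_, h0⟩ ⟨_, h1⟩ ⟨_, h2⟩).1 a
        exact (I.add_iff ⟨_, h1⟩ ⟨_, h0⟩ ⟨_, h2⟩).2 (by rw [← a, add_comm]))
      (mkV (fun _ => oneN.1) ![x.1, y.1, (addN x y).1, x.1, x.1, x.1, x.1, x.1]) (by
        simp only [List.forall_mem_cons, List.not_mem_nil, false_imp_iff, implies_true, and_true,
          Atom.Holds]
        exact ⟨x.2, y.2, (addN x y).2, (hadd _ _ _).2 rfl⟩)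
    exact ((hadd y x (addN x y)).1 this).symm
  have zero_addN : ∀ x, addN zeroN x = x := by
    intro x
    have := law_transfer D j b
      [.a 0, .a 1, .add 0 0 0] (.add 0 1 1) (by
        intro e he
        simp only [List.forall_mem_cons, List.not_mem_nil, false_imp_iff, implies_true, and_true,
          Atom.Holds] at he ⊢
        obtain ⟨h0, h1, a⟩ := he
        have a := (I.add_iff ⟨_, h0⟩ ⟨_, h0⟩ ⟨_, h0⟩).1 a
        exact (I.add_iff ⟨_, h0⟩ ⟨_, h1⟩ ⟨_, h1⟩).2 (by rw [add_eq_left.1 a, zero_add]))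
      (mkV (fun _ => oneN.1) ![zeroN.1, x.1, x.1, x.1, x.1, x.1, x.1, x.1]) (by
        simp only [List.forall_mem_cons, List.not_mem_nil, false_imp_iff, implies_true, and_true,
          Atom.Holds]
        exact ⟨zeroN.2, x.2, zero_zero⟩)
    exact (hadd zeroN x x).1 this
  have one_actN : ∀ x, actN oneN x = x := by
    intro x
    have := law_transfer D j b
      [.g 0, .a 1, .mul 0 0 0] (.act 0 1 1) (by
        intro e he
        simp only [List.forall_mem_cons, List.not_mem_nil, false_imp_iff, implies_true, and_true,
          Atom.Holds] at he ⊢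
        obtain ⟨h0, h1, a⟩ := he
        have a := (I.mul_iff ⟨_, h0⟩ ⟨_, h0⟩ ⟨_, h0⟩).1 a
        exact (I.act_iff ⟨_, h0⟩ ⟨_, h1⟩ ⟨_, h1⟩).2 (by rw [mul_eq_left.1 a, one_smul]))
      (mkV (fun _ => oneN.1) ![x.1, x.1, x.1, x.1, x.1, x.1, x.1, x.1]) (by
        simp only [List.forall_mem_cons, List.not_mem_nil, false_imp_iff, implies_true, and_true,
          Atom.Holds]
        exact ⟨oneN.2, x.2, one_one⟩)
    exact (hact oneN x x).1 this
  have mul_actN : ∀ g g' x, actN (mulN g g') x = actN g (actN g' x) := by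
    intro g g' x
    have := law_transfer D j b
      [.g 0, .g 1, .g 2, .a 0, .a 1, .a 2, .mul 0 1 2, .act 1 0 1, .act 0 1 2] (.act 2 0 2) (by
        intro e he
        simp only [List.forall_mem_cons, List.not_mem_nil, false_imp_iff, implies_true, and_true,
          Atom.Holds] at he ⊢
        obtain ⟨h0, h1, h2, k0, k1, k2, a, c, d⟩ := he
        have a := (I.mul_iff ⟨_, h0⟩ ⟨_, h1⟩ ⟨_, h2⟩).1 a
        have c := (I.act_iff ⟨_, h1⟩ ⟨_, k0⟩ ⟨_, k1⟩).1 c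
        have d := (I.act_iff ⟨_, h0⟩ ⟨_, k1⟩ ⟨_, k2⟩).1 d
        exact (I.act_iff ⟨_, h2⟩ ⟨_, k0⟩ ⟨_, k2⟩).2 (by rw [← d, ← c, ← a, mul_smul]))
      (mkV ![g.1, g'.1, (mulN g g').1, g.1, g.1, g.1, g.1, g.1]
        ![x.1, (actN g' x).1, (actN g (actN g' x)).1, x.1, x.1, x.1, x.1, x.1]) (by
        simp only [List.forall_mem_cons, List.not_mem_nil, false_imp_iff, implies_true, and_true,
          Atom.Holds]
        exact ⟨g.2, g'.2, (mulN g g').2, x.2, (actN g' x).2, (actN g (actN g' x)).2,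
          (hmul _ _ _).2 rfl, (hact _ _ _).2 rfl, (hact _ _ _).2 rfl⟩)
    exact (hact (mulN g g') x (actN g (actN g' x))).1 this
  have act_addN : ∀ g x y, actN g (addN x y) = addN (actN g x) (actN g y) := by
    intro g x y
    have := law_transfer D j b
      [.g 0, .a 0, .a 1, .a 2, .a 3, .a 4, .a 5, .add 0 1 2, .act 0 0 3, .act 0 1 4, .add 3 4 5]
      (.act 0 2 5) (by
        intro e he
        simp only [List.forall_mem_cons, List.not_mem_nil, false_imp_iff, implies_true, and_true,
          Atom.Holds] at he ⊢
        obtain ⟨h0, k0, k1, k2, k3, k4, k5, a, c, d, f⟩ := he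
        have a := (I.add_iff ⟨_, k0⟩ ⟨_, k1⟩ ⟨_, k2⟩).1 a
        have c := (I.act_iff ⟨_, h0⟩ ⟨_, k0⟩ ⟨_, k3⟩).1 c
        have d := (I.act_iff ⟨_, h0⟩ ⟨_, k1⟩ ⟨_, k4⟩).1 d
        have f := (I.add_iff ⟨_, k3⟩ ⟨_, k4⟩ ⟨_, k5⟩).1 f
        exact (I.act_iff ⟨_, h0⟩ ⟨_, k2⟩ ⟨_, k5⟩).2 (by rw [← f, ← c, ← d, ← a, smul_add]))
      (mkV (fun _ => g.1)
        ![x.1, y.1, (addN x y).1, (actN g x).1, (actN g y).1, (addN (actN g x) (actN g y)).1,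
          x.1, x.1]) (by
        simp only [List.forall_mem_cons, List.not_mem_nil, false_imp_iff, implies_true, and_true,
          Atom.Holds]
        exact ⟨g.2, x.2, y.2, (addN x y).2, (actN g x).2, (actN g y).2,
          (addN (actN g x) (actN g y)).2, (hadd _ _ _).2 rfl, (hact _ _ _).2 rfl,
          (hact _ _ _).2 rfl, (hadd _ _ _).2 rfl⟩)
    exact (hact g (addN x y) (addN (actN g x) (actN g y))).1 this
  have cocycleN : ∀ x y z,
      addN (cocN x y) (cocN (mulN x y) z) = addN (cocN x (mulN y z)) (actN x (cocN y z)) := by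
    intro x y z
    have := law_transfer D j b
      [.g 0, .g 1, .g 2, .g 3, .g 4, .a 0, .a 1, .a 2, .a 3, .a 4, .a 5,
        .mul 0 1 3, .mul 1 2 4, .coc 0 1 0, .coc 3 2 1, .coc 0 4 2, .coc 1 2 3, .act 0 3 4,
        .add 0 1 5]
      (.add 2 4 5) (by
        intro e he
        simp only [List.forall_mem_cons, List.not_mem_nil, false_imp_iff, implies_true, and_true,
          Atom.Holds] at he ⊢
        obtain ⟨h0, h1, h2, h3, h4, k0, k1, k2, k3, k4, k5, a, c, d, f, g, p, q, s⟩ := he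
        have a := (I.mul_iff ⟨_, h0⟩ ⟨_, h1⟩ ⟨_, h3⟩).1 a
        have c := (I.mul_iff ⟨_, h1⟩ ⟨_, h2⟩ ⟨_, h4⟩).1 c
        have d := (I.coc_iff ⟨_, h0⟩ ⟨_, h1⟩ ⟨_, k0⟩).1 d
        have f := (I.coc_iff ⟨_, h3⟩ ⟨_, h2⟩ ⟨_, k1⟩).1 f
        have g := (I.coc_iff ⟨_, h0⟩ ⟨_, h4⟩ ⟨_, k2⟩).1 g
        have p := (I.coc_iff ⟨_, h1⟩ ⟨_, h2⟩ ⟨_, k3⟩).1 p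
        have q := (I.act_iff ⟨_, h0⟩ ⟨_, k3⟩ ⟨_, k4⟩).1 q
        have s := (I.add_iff ⟨_, k0⟩ ⟨_, k1⟩ ⟨_, k5⟩).1 s
        exact (I.add_iff ⟨_, k2⟩ ⟨_, k4⟩ ⟨_, k5⟩).2
          (by rw [← s, ← q, ← p, ← g, ← f, ← d, ← c, ← a, I.cocycle]))
      (mkV ![x.1, y.1, z.1, (mulN x y).1, (mulN y z).1, x.1, x.1, x.1]
        ![(cocN x y).1, (cocN (mulN x y) z).1, (cocN x (mulN y z)).1, (cocN y z).1,
          (actN x (cocN y z)).1, (addN (cocN x y) (cocN (mulN x y) z)).1, zeroN.1, zeroN.1]) (by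
        simp only [List.forall_mem_cons, List.not_mem_nil, false_imp_iff, implies_true, and_true,
          Atom.Holds]
        exact ⟨x.2, y.2, z.2, (mulN x y).2, (mulN y z).2, (cocN x y).2, (cocN (mulN x y) z).2,
          (cocN x (mulN y z)).2, (cocN y z).2, (actN x (cocN y z)).2,
          (addN (cocN x y) (cocN (mulN x y) z)).2,
          (hmul _ _ _).2 rfl, (hmul _ _ _).2 rfl, (hcoc _ _ _).2 rfl, (hcoc _ _ _).2 rfl,
          (hcoc _ _ _).2 rfl, (hcoc _ _ _).2 rfl, (hact _ _ _).2 rfl, (hadd _ _ _).2 rfl⟩)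
    exact ((hadd (cocN x (mulN y z)) (actN x (cocN y z))
      (addN (cocN x y) (cocN (mulN x y) z))).1 this).symm
  have coc_one_rightN : ∀ x, addN (cocN x oneN) (cocN x oneN) = cocN x oneN := by
    intro x
    have := law_transfer D j b
      [.g 0, .g 1, .a 0, .mul 1 1 1, .coc 0 1 0] (.add 0 0 0) (by
        intro e he
        simp only [List.forall_mem_cons, List.not_mem_nil, false_imp_iff, implies_true, and_true,
          Atom.Holds] at he ⊢
        obtain ⟨h0, h1, k0, a, c⟩ := he
        have a := (I.mul_iff ⟨_, h1⟩ ⟨_, h1⟩ ⟨_, h1⟩).1 a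
        have c := (I.coc_iff ⟨_, h0⟩ ⟨_, h1⟩ ⟨_, k0⟩).1 c
        exact (I.add_iff ⟨_, k0⟩ ⟨_, k0⟩ ⟨_, k0⟩).2
          (by rw [← c, mul_eq_left.1 a, I.h_one_right, add_zero]))
      (mkV ![x.1, oneN.1, x.1, x.1, x.1, x.1, x.1, x.1] (fun _ => (cocN x oneN).1)) (by
        simp only [List.forall_mem_cons, List.not_mem_nil, false_imp_iff, implies_true, and_true,
          Atom.Holds]
        exact ⟨x.2, oneN.2, (cocN x oneN).2, one_one, (hcoc _ _ _).2 rfl⟩)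
    exact (hadd (cocN x oneN) (cocN x oneN) (cocN x oneN)).1 this
  have coc_one_leftN : ∀ x, addN (cocN oneN x) (cocN oneN x) = cocN oneN x := by
    intro x
    have := law_transfer D j b
      [.g 0, .g 1, .a 0, .mul 1 1 1, .coc 1 0 0] (.add 0 0 0) (by
        intro e he
        simp only [List.forall_mem_cons, List.not_mem_nil, false_imp_iff, implies_true, and_true,
          Atom.Holds] at he ⊢
        obtain ⟨h0, h1, k0, a, c⟩ := he
        have a := (I.mul_iff ⟨_, h1⟩ ⟨_, h1⟩ ⟨_, h1⟩).1 a
        have c := (I.coc_iff ⟨_, h1⟩ ⟨_, h0⟩ ⟨_, k0⟩).1 c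
        exact (I.add_iff ⟨_, k0⟩ ⟨_, k0⟩ ⟨_, k0⟩).2
          (by rw [← c, mul_eq_left.1 a, I.h_one_left, add_zero]))
      (mkV ![x.1, oneN.1, x.1, x.1, x.1, x.1, x.1, x.1] (fun _ => (cocN oneN x).1)) (by
        simp only [List.forall_mem_cons, List.not_mem_nil, false_imp_iff, implies_true, and_true,
          Atom.Holds]
        exact ⟨x.2, oneN.2, (cocN oneN x).2, one_one, (hcoc _ _ _).2 rfl⟩)
    exact (hadd (cocN oneN x) (cocN oneN x) (cocN oneN x)).1 this
  let iG : Group (D.Grp N) :=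
    { mul := mulN, one := oneN, inv := invN, mul_assoc := mul_assocN, one_mul := one_mulN
      mul_one := by
        let _ : Group (D.Grp N) :=
          @Group.ofLeftAxioms _ ⟨mulN⟩ ⟨invN⟩ ⟨oneN⟩ mul_assocN one_mulN hinv
        exact fun x => mul_one x
      inv_mul_cancel := hinv }
  let _ : Add (D.Ab N) := ⟨addN⟩
  let _ : Zero (D.Ab N) := ⟨zeroN⟩
  let _ : Neg (D.Ab N) := ⟨negN⟩
  let iA : AddCommGroup (D.Ab N) :=
    { add := addN, zero := zeroN, neg := negN, add_assoc := add_assocN, zero_add := zero_addN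
      add_zero := fun x => (add_commN x zeroN).trans (zero_addN x)
      add_comm := add_commN
      neg_add_cancel := hneg
      nsmul := nsmulRec
      zsmul := zsmulRec }
  have act_zeroN : ∀ g, actN g zeroN = zeroN := by
    intro g
    have h1 : actN g (zeroN + zeroN) = actN g zeroN + actN g zeroN := act_addN g zeroN zeroN
    have h2 : zeroN + zeroN = zeroN := zero_addN zeroN
    rw [h2] at h1
    exact add_eq_left.1 h1.symm
  exact ⟨{
    group := iG
    addCommGroup := iA
    action :=
      { smul := actN
        one_smul := one_actN
        mul_smul := mul_actN
        smul_zero := act_zeroN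
        smul_add := act_addN }
    h := cocN
    mul_iff := hmul
    add_iff := hadd
    act_iff := hact
    coc_iff := hcoc
    cocycle := cocycleN
    h_one_right := fun x => add_eq_left.1 (coc_one_rightN x)
    h_one_left := fun x => add_eq_left.1 (coc_one_leftN x) }⟩

/-- The interpretation of the formulas `D` in an elementary extension. (It is determined by the
formulas, so nothing depends on the choice made here.) -/
noncomputable def Interp.star (I : Interp D M b) (j : M ↪ₑ[L] N) : Interp D N (j ∘ b) :=
  Classical.choice (I.exists_extend j)

end Extend

/-! ### The group extension, and split cocycles -/

section GroupExt

variable {D : Formulas L m k r} {b : Fin r → N}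

/-- The group `G`. -/
def Interp.G (_ : Interp D N b) : Type w' := D.Grp N

/-- The abelian group `A`. -/
def Interp.A (_ : Interp D N b) : Type w' := D.Ab N

variable (I : Interp D N b)

instance : Group I.G := I.group

instance : AddCommGroup I.A := I.addCommGroup

instance : DistribMulAction I.G I.A := I.action

/-- The 2-cocycle. -/
def Interp.coc (x y : I.G) : I.A := I.h x y

theorem Interp.coc_cocycle (x y z : I.G) :
    I.coc x y + I.coc (x * y) z = I.coc x (y * z) + x • I.coc y z := I.cocycle x y z

theorem Interp.coc_one_right (x : I.G) : I.coc x 1 = 0 := I.h_one_right x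

theorem Interp.coc_one_left (x : I.G) : I.coc 1 x = 0 := I.h_one_left x

/-- The coordinates of an element of `G`. -/
def Interp.coordG (x : I.G) : Fin m → N := x.1

/-- The coordinates of an element of `A`. -/
def Interp.coordA (x : I.A) : Fin k → N := x.1

/-- The underlying set `A × G` of the extension of `G` by `A`. -/
@[ext] structure Interp.Ext (I : Interp D N b) : Type w' where
  a : I.A
  g : I.G

variable {I} in
/-- The group extension: `(a₁, g₁) * (a₂, g₂) = (a₁ + g₁ • a₂ + h(g₁, g₂), g₁ g₂)`. -/
instance : Group I.Ext where
  mul p q := ⟨p.a + p.g • q.a + I.coc p.g q.g, p.g * q.g⟩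
  one := ⟨0, 1⟩
  inv p := ⟨-(p.g⁻¹ • p.a) - I.coc p.g⁻¹ p.g, p.g⁻¹⟩
  mul_assoc p q s := by
    apply Interp.Ext.ext
    · change p.a + p.g • q.a + I.coc p.g q.g + (p.g * q.g) • s.a + I.coc (p.g * q.g) s.g =
        p.a + p.g • (q.a + q.g • s.a + I.coc q.g s.g) + I.coc p.g (q.g * s.g)
      have := I.coc_cocycle p.g q.g s.g
      rw [smul_add, smul_add, mul_smul]
      rw [← eq_sub_iff_add_eq'] at this
      rw [this]
      abel
    · exact mul_assoc _ _ _
  one_mul p := by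
    apply Interp.Ext.ext
    · change 0 + (1 : I.G) • p.a + I.coc 1 p.g = p.a
      rw [I.coc_one_left, one_smul, zero_add, add_zero]
    · exact one_mul _
  mul_one p := by
    apply Interp.Ext.ext
    · change p.a + p.g • (0 : I.A) + I.coc p.g 1 = p.a
      rw [I.coc_one_right, smul_zero, add_zero, add_zero]
    · exact mul_one _
  inv_mul_cancel p := by
    apply Interp.Ext.ext
    · change -(p.g⁻¹ • p.a) - I.coc p.g⁻¹ p.g + p.g⁻¹ • p.a + I.coc p.g⁻¹ p.g = 0
      abel
    · exact inv_mul_cancel _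

/-- The coordinates of an element of the extension. -/
def Interp.coordExt (p : I.Ext) : Fin k ⊕ Fin m → N := Sum.elim (I.coordA p.a) (I.coordG p.g)

/-- A function `h : G × G → C`, where `G` acts on the abelian group `C` via `ρ`, is split:
`h(x, y) = f(x) + x · f(y) - f(xy)` for some `f : G → C` with `f(e) = 0`. -/
def IsSplit {G C : Type*} [Group G] [AddCommGroup C] (ρ : G → C →+ C) (h : G → G → C) : Prop :=
  ∃ f : G → C, (∀ x y, h x y = f x + ρ x (f y) - f (x * y)) ∧ f 1 = 0

/-- The subgroup `A₀` of `A` generated by the image of the cocycle. -/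
def Interp.A₀ : AddSubgroup I.A := AddSubgroup.closure (range fun p : I.G × I.G => I.coc p.1 p.2)

theorem Interp.coc_mem (x y : I.G) : I.coc x y ∈ I.A₀ :=
  AddSubgroup.subset_closure ⟨(x, y), rfl⟩

theorem Interp.smul_mem_A₀ (g : I.G) {a : I.A} (ha : a ∈ I.A₀) : g • a ∈ I.A₀ := by
  have : I.A₀ ≤ I.A₀.comap (DistribSMul.toAddMonoidHom I.A g) := by
    refine (AddSubgroup.closure_le _).2 ?_
    rintro _ ⟨⟨x, y⟩, rfl⟩
    change g • I.coc x y ∈ I.A₀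
    have h := I.coc_cocycle g x y
    rw [← sub_eq_iff_eq_add'] at h
    rw [← h]
    exact I.A₀.sub_mem (I.A₀.add_mem (I.coc_mem _ _) (I.coc_mem _ _)) (I.coc_mem _ _)
  exact this ha

/-- The cocycle as a map to `A₀`. -/
def Interp.coc₀ (x y : I.G) : I.A₀ := ⟨I.coc x y, I.coc_mem x y⟩

/-- The action of `G` on `A₀`. -/
def Interp.act₀ (g : I.G) : I.A₀ →+ I.A₀ :=
  ((DistribSMul.toAddMonoidHom I.A g).comp I.A₀.subtype).codRestrict I.A₀
    (fun a => I.smul_mem_A₀ g a.2)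

/-- The action of `G` on `A₀ ⧸ Z`, for a subgroup `Z` of `A₀` stable under `G`. -/
def Interp.actQuot (Z : AddSubgroup I.A₀) (hZ : ∀ g : I.G, Z ≤ Z.comap (I.act₀ g)) (g : I.G) :
    I.A₀ ⧸ Z →+ I.A₀ ⧸ Z :=
  QuotientAddGroup.map Z Z (I.act₀ g) (hZ g)

/-- The induced cocycle with values in `A₀ ⧸ Z`. -/
def Interp.cocQuot (Z : AddSubgroup I.A₀) (x y : I.G) : I.A₀ ⧸ Z :=
  QuotientAddGroup.mk (I.coc₀ x y)

end GroupExt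

/-! ### Monster models and connected components -/

section Components

open Cardinal

/-- `N` is a monster model with respect to the (large) cardinal `κ`: it is `κ`-saturated and
strongly `κ`-homogeneous. Sets of size less than `κ` are called small, and an index is bounded
if it is less than `κ`. -/
structure IsMonster (L : FirstOrder.Language.{u, v}) (N : Type w') [L.Structure N]
    (κ : Cardinal.{w'}) : Prop where
  large : Cardinal.lift.{w'} (2 ^ max ℵ₀ L.card) < Cardinal.lift.{max u v} κ
  saturated : ∀ C : Set N, #C < κ → ∀ p : Set (L[[C]].Formula (Fin 1)),
    (∀ q : Finset (L[[C]].Formula (Fin 1)), (q : Set (L[[C]].Formula (Fin 1))) ⊆ p →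
      ∃ x : Fin 1 → N, ∀ φ ∈ q, φ.Realize x) →
    ∃ x : Fin 1 → N, ∀ φ ∈ p, φ.Realize x
  homogeneous : ∀ C : Set N, #C < κ → ∀ f : C → N,
    (∀ φ : L.Formula C, φ.Realize (fun c : C => (c : N)) ↔ φ.Realize f) →
    ∃ σ : N ≃[L] N, ∀ c : C, σ c = f c

/-- The definable closure of `B`. -/
def dcl (L : FirstOrder.Language.{u, v}) {N : Type w'} [L.Structure N] (B : Set N) : Set N :=
  {x | B.Definable₁ L {x}}

/-- A set of tuples is type-definable over `B`: it is an intersection of sets definable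
over `B`. -/
def TypeDefinable (L : FirstOrder.Language.{u, v}) {N : Type w'} [L.Structure N] (B : Set N)
    {α : Type} (X : Set (α → N)) : Prop :=
  ∃ F : Set (Set (α → N)), (∀ S ∈ F, B.Definable L S) ∧ X = ⋂₀ F

/-- A set of tuples is invariant under the automorphisms fixing `B` pointwise. -/
def Invariant (L : FirstOrder.Language.{u, v}) {N : Type w'} [L.Structure N] (B : Set N)
    {α : Type} (X : Set (α → N)) : Prop :=
  ∀ σ : N ≃[L] N, (∀ c ∈ B, σ c = c) → ∀ x ∈ X, σ ∘ x ∈ X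

/-- For a group `Γ` whose elements are tuples (via the coordinate map `c`), the smallest
subgroup of bounded index that is type-definable over `B`, i.e. the intersection of all of them
(which is again one of them in a monster model). -/
def comp00 (L : FirstOrder.Language.{u, v}) {N : Type w'} [L.Structure N] (κ : Cardinal.{w'})
    (B : Set N) {α : Type} {Γ : Type w'} [Group Γ] (c : Γ → (α → N)) : Subgroup Γ :=
  sInf {H : Subgroup Γ | #(Γ ⧸ H) < κ ∧ TypeDefinable L B (c '' (H : Set Γ))}

/-- For a group `Γ` whose elements are tuples (via the coordinate map `c`), the smallest
subgroup of bounded index that is invariant over `B`, i.e. the intersection of all of them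
(which is again one of them in a monster model). -/
def comp000 (L : FirstOrder.Language.{u, v}) {N : Type w'} [L.Structure N] (κ : Cardinal.{w'})
    (B : Set N) {α : Type} {Γ : Type w'} [Group Γ] (c : Γ → (α → N)) : Subgroup Γ :=
  sInf {H : Subgroup Γ | #(Γ ⧸ H) < κ ∧ Invariant L B (c '' (H : Set Γ))}

end Components

/-! ### The setting -/

/-- Situation (0): the group `G`, the abelian group `A` and the action of `G` on `A` are
definable without parameters in `M`, the 2-cocycle `h : G × G → A` is definable over the finite
set `B = {b₁, …, b_r}`, and its image is finite and contained in `dcl(B)`. -/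
structure Situation0 (D : Formulas L m k r) (M : Type w) [L.Structure M] (b : Fin r → M)
    extends Interp D M b where
  finite_range : (range fun p : D.Grp M × D.Grp M => h p.1 p.2).Finite
  range_dcl : ∀ (x y : D.Grp M) (i : Fin k), (h x y).1 i ∈ dcl L (range b)

/-- The inclusion `A → A*` given by an elementary embedding. -/
def Interp.toStar {D : Formulas L m k r} {b : Fin r → M} (I : Interp D M b) (j : M ↪ₑ[L] N)
    (a : I.A) : (I.star j).A :=
  ⟨j ∘ a.1, (j.map_formula D.ab a.1).2 a.2⟩

end ConnComp

open ConnComp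

universe x

namespace ConnComp

open Cardinal

/-! Both halves compare a type-definable subgroup `H` of `A* × G*` with a box `(A₀ + K) × G*`, where
`K ≤ A*` is `G*`-invariant, type-definable over `B` and of bounded index. The box is a subgroup
because `A₀` contains the values of `h*`, and its index is at most that of `K`. It is invariant over
`B`: `h*` takes only the finitely many values of `h`, these lie in `dcl(B)`, so automorphisms over
`B` fix `A₀` pointwise. It need not be type-definable. If `H ∩ A* ≤ K` and every `g` in `G` has a
lift in `H` that lies in the box, then the `A₀`-parts of such lifts split `h` modulo `K`
(`exists_splitting`).

For the first half take `K = A₁` and suppose that the two components coincide, with common value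
`H`. Being the smallest invariant component, `H` lies in the box; being the type-definable one, it
has a type-definable fiber `H ∩ A* ≤ A₀ + A₁`. The main point, `le_of_le_sup`, is that this fiber
already lies in `A₁`: compactness would make any non-trivial part in `A₀` divisible by 3, which is
impossible in `ℤⁿ`. Since `(G*)^00 = G*`, saturation shows that `H` projects onto `G*`
(`map_proj_comp00_eq_top`), so `h` splits modulo `A₁ ∩ A₀ = 0`, a contradiction.

For the second half let `H` be any type-definable subgroup of bounded index and `K = H ∩ A*`. The
intersection of `H` with the box is invariant of bounded index, so it projects onto `G*` because
`(G*)^000 = G*`. Hence `h` splits modulo `A₀ ∩ K`, strong non-splitness gives `A₀ ≤ K`, denseness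
gives `K = A*`, and `H` is everything. -/

theorem sum_elim_comp_swap {α β γ : Type*} (f : α → γ) (g : β → γ) :
    Sum.elim f g ∘ Sum.swap = Sum.elim g f := by
  funext s
  rcases s with s | s <;> rfl

/-! ### Type-definable sets -/

section TypeDefinable

variable {L : FirstOrder.Language.{u, v}} {N : Type w'} [L.Structure N] {C : Set N}
variable {α β : Type}

theorem definable_slice {S : Set (α ⊕ β → N)} (hS : C.Definable L S) {v : β → N}
    (hv : ∀ i, v i ∈ C) : C.Definable L {u : α → N | Sum.elim u v ∈ S} := by
  obtain ⟨φ, rfl⟩ := definable_iff_exists_formula_sum.1 hS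
  refine definable_iff_exists_formula_sum.2 ⟨φ.relabel
    (Sum.elim Sum.inl (Sum.elim Sum.inr fun i => Sum.inl ⟨v i, hv i⟩)), ?_⟩
  ext u
  simp only [mem_ofPred_eq, Formula.realize_relabel]
  apply iff_of_eq
  congr 1
  funext s
  rcases s with s | s | s <;> rfl

theorem definable_aut {S : Set (α → N)} (hS : C.Definable L S) {σ : N ≃[L] N}
    (hσ : ∀ c ∈ C, σ c = c) {x : α → N} (hx : x ∈ S) : σ ∘ x ∈ S := by
  obtain ⟨φ, rfl⟩ := definable_iff_exists_formula_sum.1 hS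
  simp only [mem_ofPred_eq] at hx ⊢
  rw [← StrongHomClass.realize_formula σ] at hx
  convert hx using 1
  funext s
  rcases s with s | s
  · exact (hσ _ s.2).symm
  · rfl

theorem TypeDefinable.invariant {X : Set (α → N)} (hX : TypeDefinable L C X) :
    Invariant L C X := by
  obtain ⟨F, hF, rfl⟩ := hX
  exact fun σ hσ x hx S hS => definable_aut (hF S hS) hσ (hx S hS)

theorem TypeDefinable.of_definable {X : Set (α → N)} (hX : C.Definable L X) :
    TypeDefinable L C X :=
  ⟨{X}, by simpa using hX, by simp⟩

theorem TypeDefinable.mono {C' : Set N} {X : Set (α → N)} (hX : TypeDefinable L C X)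
    (h : C ⊆ C') : TypeDefinable L C' X := by
  obtain ⟨F, hF, rfl⟩ := hX
  exact ⟨F, fun S hS => (hF S hS).mono h, rfl⟩

theorem TypeDefinable.iInter {ι : Type*} {X : ι → Set (α → N)}
    (hX : ∀ i, TypeDefinable L C (X i)) : TypeDefinable L C (⋂ i, X i) := by
  choose F hF hXF using hX
  refine ⟨⋃ i, F i, ?_, ?_⟩
  · rintro S hS
    obtain ⟨i, hi⟩ := mem_iUnion.1 hS
    exact hF i S hi
  · rw [sInter_iUnion]
    exact iInter_congr hXF

theorem TypeDefinable.inter {X Y : Set (α → N)} (hX : TypeDefinable L C X)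
    (hY : TypeDefinable L C Y) : TypeDefinable L C (X ∩ Y) := by
  rw [inter_eq_iInter]
  exact .iInter (by rintro (_ | _) <;> assumption)

theorem TypeDefinable.preimage_comp {X : Set (α → N)} (hX : TypeDefinable L C X)
    (f : α → β) : TypeDefinable L C ((fun g : β → N => g ∘ f) ⁻¹' X) := by
  obtain ⟨F, hF, rfl⟩ := hX
  refine ⟨(fun S => (fun g : β → N => g ∘ f) ⁻¹' S) '' F, ?_, ?_⟩
  · rintro _ ⟨S, hS, rfl⟩
    exact (hF S hS).preimage_comp f
  · ext x
    simp

end TypeDefinable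

/-! ### Saturation for finite tuples -/

section Saturation

variable {L : FirstOrder.Language.{u, v}} {N : Type w'} [L.Structure N] {κ : Cardinal.{w'}}

theorem IsMonster.aleph0_lt (hN : IsMonster L N κ) : ℵ₀ < κ := by
  have h : ℵ₀ < Cardinal.lift.{w'} (2 ^ max ℵ₀ L.card) := by
    rw [aleph0_lt_lift]
    exact (le_max_left _ _).trans_lt (cantor _)
  simpa using h.trans hN.large

/-- Parameter sets are finite throughout, so `ℵ₀ < κ` makes them small; the family itself may have
any size. -/
theorem IsMonster.exists_mem_of_definable_fin_one (hN : IsMonster L N κ) {ι : Type*} {C : Set N}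
    (hC : C.Finite) (F : ι → Set (Fin 1 → N)) (hF : ∀ i, C.Definable L (F i))
    (hfip : ∀ s : Finset ι, ∃ x, ∀ i ∈ s, x ∈ F i) : ∃ x, ∀ i, x ∈ F i := by
  classical
  choose φ hφ using hF
  obtain ⟨x, hx⟩ := hN.saturated C (hC.lt_aleph0.trans hN.aleph0_lt) (range φ) (by
    intro q hq
    rw [← image_univ, Finset.subset_set_image_iff] at hq
    obtain ⟨s, -, rfl⟩ := hq
    obtain ⟨x, hx⟩ := hfip s
    refine ⟨x, fun ψ hψ => ?_⟩
    obtain ⟨i, hi, rfl⟩ := Finset.mem_image.1 hψ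
    have := hx i hi
    rwa [hφ i] at this)
  refine ⟨x, fun i => ?_⟩
  rw [hφ i]
  exact hx _ ⟨i, rfl⟩

/-- Saturation is given for single elements only; tuples are realised coordinate by coordinate. The
induction hypothesis is applied to a family indexed by `Finset ι`. -/
theorem IsMonster.exists_mem_of_definable_fin (hN : IsMonster L N κ) (n : ℕ) :
    ∀ {ι : Type x} {C : Set N}, C.Finite → ∀ F : ι → Set (Fin n → N),
      (∀ i, C.Definable L (F i)) → (∀ s : Finset ι, ∃ x, ∀ i ∈ s, x ∈ F i) →
      ∃ x, ∀ i, x ∈ F i := by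
  induction n with
  | zero =>
    intro ι C _ F _ hfip
    refine ⟨default, fun i => ?_⟩
    obtain ⟨x, hx⟩ := hfip {i}
    rw [Subsingleton.elim default x]
    exact hx i (by simp)
  | succ n ih =>
    intro ι C hC F hF hfip
    let e : Fin (n + 1) ≃ Fin 1 ⊕ Fin n := (finSumFinEquiv.trans (finCongr (add_comm 1 n))).symm
    let F' : ι → Set (Fin 1 ⊕ Fin n → N) := fun i => {y | y ∘ e ∈ F i}
    have hF' : ∀ i, C.Definable L (F' i) := fun i => (hF i).preimage_comp e
    -- The last `n` coordinates `u` are chosen so that each finite subfamily can still be completed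
    -- by some first coordinate; that condition is definable over `C`.
    obtain ⟨u, hu⟩ := ih hC (fun s : Finset ι =>
        {u : Fin n → N | ∃ t : Fin 1 → N, Sum.elim u t ∈
          (fun y : Fin n ⊕ Fin 1 → N => y ∘ Sum.swap) ⁻¹' ⋂ i ∈ s, F' i})
      (fun s => ((definable_biInter_finset hF' s).preimage_comp _).exists_of_finite)
      (by
        classical
        intro q
        obtain ⟨x, hx⟩ := hfip (q.biUnion id)
        refine ⟨fun i => x (e.symm (Sum.inr i)), fun s hs => ⟨fun i => x (e.symm (Sum.inl i)), ?_⟩⟩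
        simp only [mem_preimage, mem_iInter]
        intro i hi
        have := hx i (Finset.mem_biUnion.2 ⟨s, hs, hi⟩)
        change _ ∘ e ∈ F i
        convert this using 1
        funext p
        obtain ⟨p, rfl⟩ := e.symm.surjective p
        rcases p with p | p <;> simp)
    -- With `u` added to the parameters, one-variable saturation supplies a single first coordinate
    -- for the whole family.
    obtain ⟨t, ht⟩ := hN.exists_mem_of_definable_fin_one (C := C ∪ range u)
      (hC.union (finite_range u)) (fun i => {t : Fin 1 → N | Sum.elim t u ∈ F' i})
      (fun i => definable_slice ((hF' i).mono subset_union_left) (fun p => Or.inr ⟨p, rfl⟩))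
      (by
        intro s
        obtain ⟨t, ht⟩ := hu s
        refine ⟨t, fun i hi => ?_⟩
        simp only [mem_preimage, mem_iInter] at ht
        have := ht i hi
        change Sum.elim t u ∈ F' i
        convert this using 1
        funext p
        rcases p with p | p <;> rfl)
    exact ⟨Sum.elim t u ∘ e, ht⟩

theorem IsMonster.exists_mem_of_definable (hN : IsMonster L N κ) {ι : Type*} {C : Set N}
    {α : Type} [Finite α] (hC : C.Finite) (F : ι → Set (α → N)) (hF : ∀ i, C.Definable L (F i))
    (hfip : ∀ s : Finset ι, ∃ x, ∀ i ∈ s, x ∈ F i) : ∃ x, ∀ i, x ∈ F i := by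
  obtain ⟨n, ⟨e⟩⟩ := Finite.exists_equiv_fin α
  obtain ⟨x, hx⟩ := hN.exists_mem_of_definable_fin n hC
    (fun i => (fun y : Fin n → N => y ∘ e) ⁻¹' F i) (fun i => (hF i).preimage_comp e) (by
      intro s
      obtain ⟨x, hx⟩ := hfip s
      refine ⟨x ∘ e.symm, fun i hi => ?_⟩
      rw [mem_preimage, Function.comp_assoc, Equiv.symm_comp_self]
      exact hx i hi)
  exact ⟨x ∘ e, hx⟩

theorem IsMonster.exists_mem (hN : IsMonster L N κ) {ι : Type*} {C : Set N} {α : Type} [Finite α]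
    (hC : C.Finite) (X : ι → Set (α → N)) (hX : ∀ i, TypeDefinable L C (X i))
    (hfip : ∀ s : Finset ι, ∃ x, ∀ i ∈ s, x ∈ X i) : ∃ x, ∀ i, x ∈ X i := by
  classical
  choose F hF hXF using hX
  obtain ⟨x, hx⟩ := hN.exists_mem_of_definable hC (fun p : Σ i, F i => (p.2 : Set (α → N)))
    (fun p => hF p.1 p.2 p.2.2) (by
      intro s
      obtain ⟨x, hx⟩ := hfip (s.image Sigma.fst)
      refine ⟨x, fun p hp => ?_⟩
      have := hx p.1 (Finset.mem_image_of_mem _ hp)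
      rw [hXF] at this
      exact this _ p.2.2)
  refine ⟨x, fun i => ?_⟩
  rw [hXF]
  exact fun S hS => hx ⟨i, S, hS⟩

theorem TypeDefinable.slice {C : Set N} {α β : Type} {X : Set (α ⊕ β → N)}
    (hX : TypeDefinable L C X) {v : β → N} (hv : ∀ i, v i ∈ C) :
    TypeDefinable L C {u : α → N | Sum.elim u v ∈ X} := by
  obtain ⟨F, hF, rfl⟩ := hX
  have : {u : α → N | Sum.elim u v ∈ ⋂₀ F} =
      ⋂ S : F, {u : α → N | Sum.elim u v ∈ (S : Set (α ⊕ β → N))} := by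
    ext u
    simp
  rw [this]
  exact .iInter fun S => .of_definable (definable_slice (hF S S.2) hv)

/-- By saturation a common witness exists as soon as every finite subfamily has one, so the
projection is the intersection of the definable projections of finite intersections. -/
theorem TypeDefinable.exists (hN : IsMonster L N κ) {C : Set N} (hC : C.Finite) {α β : Type}
    [Finite α] [Finite β] {X : Set (α ⊕ β → N)} (hX : TypeDefinable L C X) :
    TypeDefinable L C {u : α → N | ∃ t : β → N, Sum.elim u t ∈ X} := by
  obtain ⟨F, hF, rfl⟩ := hX
  have : {u : α → N | ∃ t : β → N, Sum.elim u t ∈ ⋂₀ F} =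
      ⋂ s : Finset F, {u : α → N | ∃ t : β → N, Sum.elim u t ∈ ⋂ i ∈ s, (i : Set (α ⊕ β → N))} := by
    ext u
    simp only [mem_ofPred_eq, mem_sInter, mem_iInter]
    constructor
    · rintro ⟨t, ht⟩ s
      exact ⟨t, fun i _ => ht i i.2⟩
    · intro h
      obtain ⟨t, ht⟩ := hN.exists_mem_of_definable (C := C ∪ range u)
        (hC.union (finite_range u))
        (fun i : F => {t : β → N | Sum.elim t u ∈
          (fun y : β ⊕ α → N => y ∘ Sum.swap) ⁻¹' (i : Set (α ⊕ β → N))})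
        (fun i => definable_slice (((hF i i.2).preimage_comp _).mono subset_union_left)
          (fun p => Or.inr ⟨p, rfl⟩))
        (by
          intro s
          obtain ⟨t, ht⟩ := h s
          refine ⟨t, fun i hi => ?_⟩
          simp only [mem_ofPred_eq, mem_preimage, sum_elim_comp_swap]
          exact ht i hi)
      refine ⟨t, fun S hS => ?_⟩
      have := ht ⟨S, hS⟩
      simpa only [mem_ofPred_eq, mem_preimage, sum_elim_comp_swap] using this
  rw [this]
  exact .iInter fun s => .of_definable
    (definable_biInter_finset (fun i : F => hF i i.2) s).exists_of_finite

end Saturation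

/-! ### Type-definable subsets of `A` -/

section Closure

variable {L : FirstOrder.Language.{u, v}} {N : Type w'} [L.Structure N] {κ : Cardinal.{w'}}
variable {m k r : ℕ} {D : Formulas L m k r} {b : Fin r → N} (I : Interp D N b) {C : Set N}

theorem definable_realize {α : Type} (φ : L.Formula α) : C.Definable L {x : α → N | φ.Realize x} :=
  (empty_definable_iff.2 ⟨φ, rfl⟩ : (∅ : Set N).Definable L _).mono (empty_subset C)

theorem definable_holds₃ {α : Type} {p q s : ℕ} (φ : L.Formula (Fin p ⊕ Fin q ⊕ Fin s))
    (e : Fin p → α) (f : Fin q → α) (g : Fin s → α) :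
    C.Definable L {x : α → N | Holds₃ φ (x ∘ e) (x ∘ f) (x ∘ g)} := by
  convert (definable_realize (C := C) φ).preimage_comp (Sum.elim e (Sum.elim f g)) using 1
  ext x
  simp only [mem_ofPred_eq, mem_preimage, Holds₃, Sum.comp_elim]

theorem definable_singleton {α : Type} [Finite α] {a : α → N} (ha : ∀ i, a i ∈ C) :
    C.Definable L {a} := by
  have : ({a} : Set (α → N)) = ⋂ i, {x : α → N | x i = a i} := by
    ext x
    simp [funext_iff]
  rw [this]
  exact definable_iInter_of_finite fun i => DefinableFun.ofPred_eq_const (.proj L) (ha i)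

namespace Interp

theorem coordA_injective : Function.Injective I.coordA := Subtype.val_injective

theorem coordG_injective : Function.Injective I.coordG := Subtype.val_injective

theorem coordExt_injective : Function.Injective I.coordExt := by
  intro p q h
  exact Ext.ext (I.coordA_injective (funext fun i => congrFun h (Sum.inl i)))
    (I.coordG_injective (funext fun i => congrFun h (Sum.inr i)))

theorem range_coordA : range I.coordA = {x | D.ab.Realize x} := Subtype.range_val

theorem holds_add (x y z : I.A) :
    Holds₃ D.add (I.coordA x) (I.coordA y) (I.coordA z) ↔ x + y = z := I.add_iff x y z

theorem holds_mul (x y z : I.G) :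
    Holds₃ D.mul (I.coordG x) (I.coordG y) (I.coordG z) ↔ x * y = z := I.mul_iff x y z

/-- A ternary relation on `A` given by a definable set turns two type-definable sets into a third
one. -/
theorem typeDefinable_rel (hN : IsMonster L N κ) (hC : C.Finite)
    {R : I.A → I.A → I.A → Prop} {S : Set (Fin k ⊕ Fin k ⊕ Fin k → N)} (hS : C.Definable L S)
    (hR : ∀ x u v, Sum.elim (I.coordA x) (Sum.elim (I.coordA u) (I.coordA v)) ∈ S ↔ R x u v)
    {U V : Set I.A} (hU : TypeDefinable L C (I.coordA '' U))
    (hV : TypeDefinable L C (I.coordA '' V)) :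
    TypeDefinable L C (I.coordA '' {x | ∃ u ∈ U, ∃ v ∈ V, R x u v}) := by
  have h := (TypeDefinable.of_definable (definable_realize (C := C) D.ab)).inter
    (((TypeDefinable.of_definable hS).inter
      ((hU.preimage_comp (fun i => (Sum.inr (Sum.inl i) : Fin k ⊕ Fin k ⊕ Fin k))).inter
        (hV.preimage_comp (fun i => (Sum.inr (Sum.inr i) : Fin k ⊕ Fin k ⊕ Fin k))))).exists hN hC)
  convert h using 1
  ext x
  simp only [mem_image, mem_inter_iff, mem_ofPred_eq, mem_preimage]
  constructor
  · rintro ⟨x, ⟨u, hu, v, hv, hr⟩, rfl⟩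
    exact ⟨x.2, Sum.elim (I.coordA u) (I.coordA v), (hR x u v).2 hr, ⟨u, hu, rfl⟩, ⟨v, hv, rfl⟩⟩
  · rintro ⟨hx, t, ht, ⟨u, hu, hut⟩, ⟨v, hv, hvt⟩⟩
    refine ⟨⟨x, hx⟩, ⟨u, hu, v, hv, (hR _ _ _).1 ?_⟩, rfl⟩
    rw [hut, hvt]
    convert ht using 1
    funext s
    rcases s with s | s | s <;> rfl

theorem typeDefinable_univ : TypeDefinable L C (I.coordA '' univ) := by
  rw [image_univ, range_coordA]
  exact .of_definable (definable_realize _)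

theorem typeDefinable_singleton {a : I.A} (ha : ∀ i, I.coordA a i ∈ C) :
    TypeDefinable L C (I.coordA '' {a}) := by
  rw [image_singleton]
  exact .of_definable (definable_singleton ha)

theorem typeDefinable_add (hN : IsMonster L N κ) (hC : C.Finite) {U V : Set I.A}
    (hU : TypeDefinable L C (I.coordA '' U)) (hV : TypeDefinable L C (I.coordA '' V)) :
    TypeDefinable L C (I.coordA '' {x | ∃ u ∈ U, ∃ v ∈ V, u + v = x}) :=
  I.typeDefinable_rel hN hC
    (definable_holds₃ D.add (fun i => Sum.inr (Sum.inl i)) (fun i => Sum.inr (Sum.inr i)) Sum.inl)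
    (fun x u v => I.holds_add u v x) hU hV

theorem typeDefinable_image_two_pow (hN : IsMonster L N κ) (hC : C.Finite) {U : Set I.A}
    (hU : TypeDefinable L C (I.coordA '' U)) (n : ℕ) :
    TypeDefinable L C (I.coordA '' {x | ∃ u ∈ U, (2 ^ n : ℤ) • u = x}) := by
  induction n with
  | zero => simpa using hU
  | succ n ih =>
    -- Doubling is iterated; the third variable of the relation is a dummy.
    convert I.typeDefinable_rel hN hC (R := fun x u _ => u + u = x)
      (definable_holds₃ D.add (fun i => Sum.inr (Sum.inl i)) (fun i => Sum.inr (Sum.inl i)) Sum.inl)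
      (fun x u v => I.holds_add u u x) ih I.typeDefinable_univ using 2
    ext x
    simp only [mem_ofPred_eq, mem_univ, true_and, exists_const]
    constructor
    · rintro ⟨u, hu, rfl⟩
      exact ⟨_, ⟨u, hu, rfl⟩, by rw [← two_zsmul, smul_smul, pow_succ']⟩
    · rintro ⟨_, ⟨u, hu, rfl⟩, rfl⟩
      exact ⟨u, hu, by rw [← two_zsmul, smul_smul, pow_succ']⟩

theorem typeDefinable_preimage_three (hN : IsMonster L N κ) (hC : C.Finite) {U : Set I.A}
    (hU : TypeDefinable L C (I.coordA '' U)) :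
    TypeDefinable L C (I.coordA '' {x | (3 : ℤ) • x ∈ U}) := by
  -- The auxiliary variable `v` carries `2x`, so that `u = 3x` is expressed by two additions.
  convert I.typeDefinable_rel hN hC (R := fun x u v => x + x = v ∧ v + x = u)
    ((definable_holds₃ D.add Sum.inl Sum.inl (fun i => Sum.inr (Sum.inr i))).inter
      (definable_holds₃ D.add (fun i => Sum.inr (Sum.inr i)) Sum.inl (fun i => Sum.inr (Sum.inl i))))
    (fun x u v => and_congr (I.holds_add x x v) (I.holds_add v x u)) hU I.typeDefinable_univ using 2
  ext x
  have : (3 : ℤ) • x = x + x + x := by abel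
  simp [this]

/-- A type-definable subgroup which is contained in `E + W`, where `E` meets `W` trivially and has
no non-zero elements divisible by all powers of 2, or by all powers of 3, is contained in `W`. -/
theorem le_of_le_sup (hN : IsMonster L N κ) (hC : C.Finite) {X W E : AddSubgroup I.A}
    (hX : TypeDefinable L C (I.coordA '' (X : Set I.A)))
    (hW : TypeDefinable L C (I.coordA '' (W : Set I.A))) (hEW : ∀ a ∈ E, a ∈ W → a = 0)
    (hE₂ : ∀ a ∈ E, (∀ n : ℕ, ∃ c ∈ E, a = (2 ^ n : ℤ) • c) → a = 0)
    (hE₃ : ∀ a ∈ E, (∀ n : ℕ, ∃ c ∈ E, a = (3 ^ n : ℤ) • c) → a = 0) (hXE : X ≤ E ⊔ W) :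
    X ≤ W := by
  obtain ⟨Y, hXY, hWY, hYE, hY⟩ : ∃ Y : AddSubgroup I.A, X ≤ Y ∧ W ≤ Y ∧ Y ≤ E ⊔ W ∧
      TypeDefinable L C (I.coordA '' (Y : Set I.A)) := by
    -- Adding `W` to `X` ensures that the `E`-components of elements of `Y` stay in `Y`, so `Y = (E
    -- ∩ Y) + W`; it remains to show `E ∩ Y = 0`.
    refine ⟨X ⊔ W, le_sup_left, le_sup_right, sup_le hXE le_sup_right, ?_⟩
    convert I.typeDefinable_add hN hC hX hW using 2
    ext x
    simp [AddSubgroup.mem_sup]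
  have split : ∀ y ∈ Y, ∃ e ∈ E, e ∈ Y ∧ y - e ∈ W := by
    intro y hy
    obtain ⟨e, he, w, hw, rfl⟩ := AddSubgroup.mem_sup.1 (hYE hy)
    refine ⟨e, he, ?_, by simpa using hw⟩
    simpa using Y.sub_mem hy (hWY hw)
  -- Saturation makes `Y / W ≅ E ∩ Y` behave like a 2-adically complete group, in which 3 is
  -- invertible: a solution of `3x = c` modulo every `2 ^ n` gives an exact one.
  have third : ∀ c ∈ E, c ∈ Y → ∃ e ∈ E, e ∈ Y ∧ c = (3 : ℤ) • e := by
    intro c hcE hcY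
    let C' : Set N := C ∪ range (I.coordA c)
    have hC' : C'.Finite := hC.union (finite_range _)
    have hCC' : C ⊆ C' := subset_union_left
    let T : ℕ → Set I.A := fun n =>
      {x | x ∈ Y ∧ ∃ y ∈ Y, (3 : ℤ) • x - c - (2 ^ n : ℤ) • y ∈ W}
    have hT : ∀ n, TypeDefinable L C' (I.coordA '' T n) := by
      intro n
      have h := (hY.mono hCC').inter (I.typeDefinable_preimage_three hN hC'
        (I.typeDefinable_add hN hC' (I.typeDefinable_singleton (a := c) fun i => Or.inr ⟨i, rfl⟩)
          (I.typeDefinable_add hN hC' (I.typeDefinable_image_two_pow hN hC' (hY.mono hCC') n)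
            (hW.mono hCC'))))
      rw [← image_inter I.coordA_injective] at h
      convert h using 2
      ext x
      simp only [T, mem_inter_iff, mem_ofPred_eq, SetLike.mem_coe, mem_singleton_iff,
        exists_eq_left]
      refine and_congr_right fun _ => ⟨?_, ?_⟩
      · rintro ⟨y, hy, hw⟩
        exact ⟨_, ⟨_, ⟨y, hy, rfl⟩, _, hw, rfl⟩, by abel⟩
      · rintro ⟨_, ⟨_, ⟨y, hy, rfl⟩, w, hw, rfl⟩, h⟩
        refine ⟨y, hy, ?_⟩
        rw [← h]
        convert hw using 1
        abel
    have hT_anti : ∀ n n', n ≤ n' → T n' ⊆ T n := by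
      rintro n n' hn x ⟨hx, y, hy, h⟩
      obtain ⟨d, rfl⟩ := Nat.exists_eq_add_of_le hn
      refine ⟨hx, (2 ^ d : ℤ) • y, Y.zsmul_mem hy _, ?_⟩
      rwa [smul_smul, ← pow_add]
    have hT_ne : ∀ n, (T n).Nonempty := by
      intro n
      -- From `3s + 2ⁿt = 1`, the element `s • c` solves `3x = c` up to the multiple `2ⁿ • (-(t •
      -- c))`.
      obtain ⟨s, t, hst⟩ : IsCoprime (3 : ℤ) (2 ^ n) :=
        IsCoprime.pow_right (by norm_num)
      refine ⟨s • c, Y.zsmul_mem hcY _, -(t • c), Y.neg_mem (Y.zsmul_mem hcY _), ?_⟩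
      have : (3 : ℤ) • s • c - c - (2 ^ n : ℤ) • -(t • c) = (s * 3 + t * 2 ^ n - 1) • c := by
        module
      rw [this, hst, sub_self, zero_smul]
      exact W.zero_mem
    obtain ⟨x, hx⟩ := hN.exists_mem hC' (fun n => I.coordA '' T n) hT (by
      intro s
      obtain ⟨x, hx⟩ := hT_ne (s.sup id)
      exact ⟨I.coordA x, fun n hn => ⟨x, hT_anti _ _ (Finset.le_sup (f := id) hn) hx, rfl⟩⟩)
    obtain ⟨x, -, rfl⟩ := hx 0
    have hx : ∀ n, x ∈ T n := fun n => by
      obtain ⟨x', hx', h⟩ := hx n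
      rwa [← I.coordA_injective h]
    obtain ⟨e, heE, heY, hew⟩ := split x (hx 0).1
    refine ⟨e, heE, heY, ?_⟩
    -- For the `E`-component `e` of the common solution, `3e - c` is divisible by every `2 ^ n` in
    -- `E`, hence zero.
    refine (sub_eq_zero.1 (hE₂ _ (E.sub_mem (E.zsmul_mem heE 3) hcE) fun n => ?_)).symm
    obtain ⟨-, y, hy, hw⟩ := hx n
    obtain ⟨e', heE', -, hew'⟩ := split y hy
    refine ⟨e', heE', sub_eq_zero.1 (hEW _ (E.sub_mem (E.sub_mem (E.zsmul_mem heE 3) hcE)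
      (E.zsmul_mem heE' _)) ?_)⟩
    -- Passing to `E`-components changes the expression only by elements of `W`; it also lies in
    -- `E`, so `hEW` kills it.
    have : (3 : ℤ) • e - c - (2 ^ n : ℤ) • e' = ((3 : ℤ) • x - c - (2 ^ n : ℤ) • y) -
        (3 : ℤ) • (x - e) + (2 ^ n : ℤ) • (y - e') := by
      module
    rw [this]
    exact W.add_mem (W.sub_mem hw (W.zsmul_mem hew 3)) (W.zsmul_mem hew' _)
  have zero : ∀ c ∈ E, c ∈ Y → c = 0 := by
    intro c hcE hcY
    -- Dividing by 3 inside `E ∩ Y` can be repeated indefinitely.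
    refine hE₃ c hcE fun n => ?_
    suffices ∃ e ∈ E, e ∈ Y ∧ c = (3 ^ n : ℤ) • e by
      obtain ⟨e, he, -, h⟩ := this
      exact ⟨e, he, h⟩
    induction n with
    | zero => exact ⟨c, hcE, hcY, by simp⟩
    | succ n ih =>
      obtain ⟨e, he, heY, rfl⟩ := ih
      obtain ⟨e', he', heY', rfl⟩ := third e he heY
      exact ⟨e', he', heY', by rw [smul_smul, pow_succ]⟩
  intro x hx
  obtain ⟨e, he, heY, hew⟩ := split x (hXY hx)
  simpa [zero e he heY] using hew

end Interp

end Closure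

/-! ### Indices of subgroups -/

section Index

theorem mk_quotient_le_of_comap_le {Γ Δ : Type w'} [Group Γ] [Group Δ] (f : Γ →* Δ)
    (hf : Function.Surjective f) {H : Subgroup Γ} {K : Subgroup Δ} (h : H ≤ K.comap f) :
    #(Δ ⧸ K) ≤ #(Γ ⧸ H) := by
  refine mk_le_of_surjective (f := Quotient.map' f fun a c hac => ?_) ?_
  · rw [QuotientGroup.leftRel_apply] at hac ⊢
    simpa using h hac
  · rintro ⟨y⟩
    obtain ⟨x, rfl⟩ := hf y
    exact ⟨QuotientGroup.mk x, rfl⟩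

theorem mk_quotient_inf_lt {Γ : Type w'} [Group Γ] {κ : Cardinal.{w'}} (hκ : ℵ₀ ≤ κ)
    {H K : Subgroup Γ} (hH : #(Γ ⧸ H) < κ) (hK : #(Γ ⧸ K) < κ) :
    #(Γ ⧸ (H ⊓ K : Subgroup Γ)) < κ := by
  refine lt_of_le_of_lt ?_ (mul_lt_of_lt hκ hH hK)
  rw [mul_def]
  let f : Γ ⧸ (H ⊓ K : Subgroup Γ) → (Γ ⧸ H) × (Γ ⧸ K) := fun q =>
    (Subgroup.quotientMapOfLE inf_le_left q, Subgroup.quotientMapOfLE inf_le_right q)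
  refine mk_le_of_injective (f := f) ?_
  rintro ⟨x⟩ ⟨y⟩ h
  obtain ⟨h1, h2⟩ := Prod.ext_iff.1 h
  exact QuotientGroup.eq.2 ⟨QuotientGroup.eq.1 h1, QuotientGroup.eq.1 h2⟩

end Index

/-! ### Divisibility in finitely generated torsion-free groups -/

section Divisible

/-- The group is free of finite rank, and a non-zero integer coordinate cannot be a multiple of a
power of `p` exceeding its absolute value. -/
theorem eq_zero_of_forall_pow_smul {E : Type*} [AddCommGroup E] [AddGroup.FG E]
    [IsAddTorsionFree E] {p : ℤ} (hp : 1 < p) {a : E} (h : ∀ n : ℕ, ∃ c : E, a = p ^ n • c) :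
    a = 0 := by
  have : Module.Finite ℤ E := Module.Finite.iff_addGroup_fg.2 inferInstance
  let B := Module.Free.chooseBasis ℤ E
  rw [← B.repr.map_eq_zero_iff]
  ext i
  by_contra hne
  obtain ⟨n, hn⟩ : ∃ n : ℕ, (B.repr a i).natAbs < p.natAbs ^ n :=
    pow_unbounded_of_one_lt _ (by omega)
  obtain ⟨c, rfl⟩ := h n
  simp only [map_smul, Finsupp.smul_apply, smul_eq_mul, Int.natAbs_mul, Int.natAbs_pow,
    Finsupp.coe_zero, Pi.zero_apply, mul_eq_zero, not_or] at hn hne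
  exact hn.not_ge (Nat.le_mul_of_pos_right _ (Nat.pos_of_ne_zero (Int.natAbs_ne_zero.2 hne.2)))

end Divisible

/-! ### Subgroups of the extension -/

section Extension

variable {L : FirstOrder.Language.{u, v}} {N : Type w'} [L.Structure N] {κ : Cardinal.{w'}}
variable {m k r : ℕ} {D : Formulas L m k r} {b : Fin r → N} (I : Interp D N b) {C : Set N}

namespace Interp

theorem mk_mul (a₁ a₂ : I.A) (g₁ g₂ : I.G) :
    (⟨a₁, g₁⟩ * ⟨a₂, g₂⟩ : I.Ext) = ⟨a₁ + g₁ • a₂ + I.coc g₁ g₂, g₁ * g₂⟩ := rfl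

theorem mk_one_mul (a₁ a₂ : I.A) (g : I.G) : (⟨a₁, 1⟩ * ⟨a₂, g⟩ : I.Ext) = ⟨a₁ + a₂, g⟩ := by
  rw [mk_mul, coc_one_left, one_smul, add_zero, one_mul]

/-- The projection of the extension onto `G`. -/
def proj : I.Ext →* I.G where
  toFun p := p.g
  map_one' := rfl
  map_mul' _ _ := rfl

theorem proj_surjective : Function.Surjective I.proj := fun g => ⟨⟨0, g⟩, rfl⟩

/-- The inclusion of `A` into the extension. -/
def incl : Multiplicative I.A →* I.Ext where
  toFun a := ⟨a.toAdd, 1⟩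
  map_one' := rfl
  map_mul' a c := (I.mk_one_mul a.toAdd c.toAdd 1).symm

/-- The intersection of a subgroup of the extension with `A`. -/
def fiber (H : Subgroup I.Ext) : AddSubgroup I.A := (H.comap I.incl).toAddSubgroup'

variable {I} in
theorem mem_fiber {H : Subgroup I.Ext} {a : I.A} : a ∈ I.fiber H ↔ (⟨a, 1⟩ : I.Ext) ∈ H := Iff.rfl

theorem sub_mem_fiber {H : Subgroup I.Ext} {a c : I.A} {g : I.G} (ha : (⟨a, g⟩ : I.Ext) ∈ H)
    (hc : (⟨c, g⟩ : I.Ext) ∈ H) : a - c ∈ I.fiber H := by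
  rw [mem_fiber, ← H.mul_mem_cancel_right hc, mk_one_mul, sub_add_cancel]
  exact ha

/-- Conjugating `(a, 1)` by a lift `(c, g)` in `H` gives `(g • a, 1)`; the proof uses the form `(g •
a, 1)(c, g) = (c, g)(a, 1)`. -/
theorem smul_mem_fiber {H : Subgroup I.Ext} (hH : H.map I.proj = ⊤) (g : I.G) {a : I.A}
    (ha : a ∈ I.fiber H) : g • a ∈ I.fiber H := by
  obtain ⟨⟨c, g⟩, hc, rfl⟩ : g ∈ H.map I.proj := hH ▸ Subgroup.mem_top g
  rw [mem_fiber] at ha ⊢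
  rw [← H.mul_mem_cancel_right hc, mk_one_mul]
  have := H.mul_mem hc ha
  rwa [mk_mul, coc_one_right, mul_one, add_zero, add_comm c] at this

theorem mk_one_inv_mul_mem {H : Subgroup I.Ext} {a c : I.A} :
    (⟨a, 1⟩ : I.Ext)⁻¹ * ⟨c, 1⟩ ∈ H ↔ -a + c ∈ I.fiber H := by
  have : (⟨a, 1⟩ : I.Ext)⁻¹ * ⟨c, 1⟩ = I.incl (Multiplicative.ofAdd (-a + c)) := by
    rw [ofAdd_add, ofAdd_neg, map_mul, map_inv]
    rfl
  rw [this]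
  rfl

theorem mk_quotient_fiber_le (H : Subgroup I.Ext) : #(I.A ⧸ I.fiber H) ≤ #(I.Ext ⧸ H) := by
  refine mk_le_of_injective
    (f := Quotient.lift (fun a : I.A => (QuotientGroup.mk (⟨a, 1⟩ : I.Ext) : I.Ext ⧸ H)) ?_) ?_
  · intro a c h
    exact QuotientGroup.eq.2 (I.mk_one_inv_mul_mem.2 (QuotientAddGroup.leftRel_apply.1 h))
  · rintro ⟨a⟩ ⟨c⟩ h
    exact QuotientAddGroup.eq.2 (I.mk_one_inv_mul_mem.1 (QuotientGroup.eq.1 h))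

/-- The subgroup `W × G` of the extension, for a `G`-invariant subgroup `W ⊇ A₀` of `A`. -/
def box (W : AddSubgroup I.A) (hW : ∀ g : I.G, ∀ a ∈ W, g • a ∈ W) (h₀ : I.A₀ ≤ W) :
    Subgroup I.Ext where
  carrier := {p | p.a ∈ W}
  one_mem' := W.zero_mem
  mul_mem' hp hq :=
    W.add_mem (W.add_mem hp (hW _ _ hq)) (h₀ (I.coc_mem _ _))
  inv_mem' hp :=
    W.sub_mem (W.neg_mem (hW _ _ hp)) (h₀ (I.coc_mem _ _))

/-- Since `(a, g) = (a, 1)(0, g)` and `(0, g)` is in the box, every coset has a representative in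
`A`. -/
theorem mk_quotient_box_le {V W : AddSubgroup I.A} (hW : ∀ g : I.G, ∀ a ∈ W, g • a ∈ W)
    (h₀ : I.A₀ ≤ W) (hVW : V ≤ W) : #(I.Ext ⧸ I.box W hW h₀) ≤ #(I.A ⧸ V) := by
  refine mk_le_of_surjective
    (f := Quotient.lift
      (fun a : I.A => (QuotientGroup.mk (⟨a, 1⟩ : I.Ext) : I.Ext ⧸ I.box W hW h₀)) ?_) ?_
  · intro a c h
    exact QuotientGroup.eq.2 (I.mk_one_inv_mul_mem.2 (hVW (QuotientAddGroup.leftRel_apply.1 h)))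
  · rintro ⟨⟨a, g⟩⟩
    have hg : (⟨0, g⟩ : I.Ext) ∈ I.box W hW h₀ := W.zero_mem
    refine ⟨QuotientAddGroup.mk a, ?_⟩
    change (QuotientGroup.mk (⟨a, 1⟩ : I.Ext) : I.Ext ⧸ I.box W hW h₀) =
      QuotientGroup.mk (⟨a, g⟩ : I.Ext)
    rw [← QuotientGroup.mk_mul_of_mem (⟨a, 1⟩ : I.Ext) hg, mk_one_mul, add_zero]

/-- The action of an automorphism on `A`. -/
def autA (σ : N ≃[L] N) : I.A → I.A :=
  fun a => ⟨σ ∘ I.coordA a, (StrongHomClass.realize_formula σ D.ab).2 a.2⟩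

/-- The action of an automorphism on `G`. -/
def autG (σ : N ≃[L] N) : I.G → I.G :=
  fun a => ⟨σ ∘ I.coordG a, (StrongHomClass.realize_formula σ D.grp).2 a.2⟩

theorem autA_add (σ : N ≃[L] N) (a c : I.A) : I.autA σ (a + c) = I.autA σ a + I.autA σ c := by
  refine ((I.holds_add _ _ _).1 ?_).symm
  have := (I.holds_add a c _).2 rfl
  unfold Holds₃ at this ⊢
  rw [← StrongHomClass.realize_formula σ] at this
  simp only [Sum.comp_elim] at this
  exact this

theorem invariant_iff {B : Set N} {U : Set I.A} : Invariant L B (I.coordA '' U) ↔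
    ∀ σ : N ≃[L] N, (∀ c ∈ B, σ c = c) → ∀ a ∈ U, I.autA σ a ∈ U := by
  refine forall₂_congr fun σ _ => ⟨fun h a ha => ?_, ?_⟩
  · obtain ⟨a', ha', h'⟩ := h _ ⟨a, ha, rfl⟩
    rwa [← show a' = I.autA σ a from I.coordA_injective h']
  · rintro h _ ⟨a, ha, rfl⟩
    exact ⟨_, h a ha, rfl⟩

theorem invariant_sup {B : Set N} {U V : AddSubgroup I.A}
    (hU : Invariant L B (I.coordA '' (U : Set I.A))) (hV : Invariant L B (I.coordA '' (V : Set I.A))) :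
    Invariant L B (I.coordA '' ((U ⊔ V : AddSubgroup I.A) : Set I.A)) := by
  rw [invariant_iff] at *
  intro σ hσ a ha
  obtain ⟨u, hu, v, hv, rfl⟩ := AddSubgroup.mem_sup.1 ha
  rw [autA_add]
  exact AddSubgroup.add_mem_sup (hU σ hσ u hu) (hV σ hσ v hv)

theorem invariant_box {B : Set N} {W : AddSubgroup I.A} (hW : ∀ g : I.G, ∀ a ∈ W, g • a ∈ W)
    (h₀ : I.A₀ ≤ W) (h : Invariant L B (I.coordA '' (W : Set I.A))) :
    Invariant L B (I.coordExt '' (I.box W hW h₀ : Set I.Ext)) := by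
  rw [invariant_iff] at h
  rintro σ hσ _ ⟨p, hp, rfl⟩
  refine ⟨⟨I.autA σ p.a, I.autG σ p.g⟩, h σ hσ _ hp, ?_⟩
  funext s
  rcases s with s | s <;> rfl

theorem invariant_map_proj {B : Set N} {H : Subgroup I.Ext}
    (h : Invariant L B (I.coordExt '' (H : Set I.Ext))) :
    Invariant L B (I.coordG '' (H.map I.proj : Set I.G)) := by
  rintro σ hσ _ ⟨_, ⟨p, hp, rfl⟩, rfl⟩
  obtain ⟨q, hq, h⟩ := h σ hσ _ ⟨p, hp, rfl⟩
  exact ⟨_, ⟨q, hq, rfl⟩, funext fun i => congrFun h (Sum.inr i)⟩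

theorem typeDefinable_map_proj (hN : IsMonster L N κ) (hC : C.Finite) {H : Subgroup I.Ext}
    (hH : TypeDefinable L C (I.coordExt '' (H : Set I.Ext))) :
    TypeDefinable L C (I.coordG '' (H.map I.proj : Set I.G)) := by
  convert (hH.preimage_comp Sum.swap).exists hN hC using 1
  ext x
  simp only [mem_image, mem_ofPred_eq, mem_preimage, sum_elim_comp_swap]
  constructor
  · rintro ⟨_, ⟨p, hp, rfl⟩, rfl⟩
    exact ⟨I.coordA p.a, p, hp, rfl⟩
  · rintro ⟨t, p, hp, h⟩
    exact ⟨_, ⟨p, hp, rfl⟩, funext fun i => congrFun h (Sum.inr i)⟩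

theorem typeDefinable_fiber (hN : IsMonster L N κ) (hC : C.Finite) {H : Subgroup I.Ext}
    (hH : TypeDefinable L C (I.coordExt '' (H : Set I.Ext))) :
    TypeDefinable L C (I.coordA '' (I.fiber H : Set I.A)) := by
  -- The condition `g = 1` is written as `g * g = g`, so the identity is not needed as a parameter.
  convert (hH.inter (.of_definable
    (definable_holds₃ D.mul Sum.inr Sum.inr Sum.inr))).exists hN hC using 1
  ext x
  simp only [mem_image, mem_ofPred_eq, mem_inter_iff, Sum.elim_comp_inr]
  constructor
  · rintro ⟨a, ha, rfl⟩
    exact ⟨I.coordG 1, ⟨_, ha, rfl⟩, (I.holds_mul 1 1 1).2 (mul_one 1)⟩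
  · rintro ⟨t, ⟨⟨a, g⟩, hp, h⟩, hm⟩
    have ht : t = I.coordG g := funext fun i => (congrFun h (Sum.inr i)).symm
    rw [ht, holds_mul] at hm
    obtain rfl : g = 1 := mul_eq_left.1 hm
    exact ⟨a, hp, funext fun i => congrFun h (Sum.inl i)⟩

theorem typeDefinable_range_coordExt : TypeDefinable L C (range I.coordExt) := by
  have h := ((definable_realize (C := C) D.ab).preimage_comp (Sum.inl : Fin k → Fin k ⊕ Fin m)).inter
    ((definable_realize (C := C) D.grp).preimage_comp Sum.inr)
  convert TypeDefinable.of_definable h using 1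
  ext x
  constructor
  · rintro ⟨p, rfl⟩
    exact ⟨p.a.2, p.g.2⟩
  · rintro ⟨ha, hg⟩
    exact ⟨⟨⟨_, ha⟩, ⟨_, hg⟩⟩, Sum.elim_comp_inl_inr x⟩

theorem map_proj_eq_top (hN : IsMonster L N κ) (hC : C.Finite) (hG : comp00 L κ C I.coordG = ⊤)
    {H : Subgroup I.Ext} (hH : TypeDefinable L C (I.coordExt '' (H : Set I.Ext)))
    (hi : #(I.Ext ⧸ H) < κ) : H.map I.proj = ⊤ :=
  sInf_eq_top.1 hG _ ⟨(mk_quotient_le_of_comap_le I.proj I.proj_surjective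
    (Subgroup.le_comap_map _ _)).trans_lt hi, I.typeDefinable_map_proj hN hC hH⟩

theorem typeDefinable_comp00 : TypeDefinable L C
    (I.coordExt '' (comp00 L κ C I.coordExt : Set I.Ext)) := by
  have : I.coordExt '' (comp00 L κ C I.coordExt : Set I.Ext) = range I.coordExt ∩
      ⋂ H : {H : Subgroup I.Ext | #(I.Ext ⧸ H) < κ ∧
        TypeDefinable L C (I.coordExt '' (H : Set I.Ext))}, I.coordExt '' (H : Set I.Ext) := by
    ext x
    simp only [comp00, Subgroup.coe_sInf, mem_inter_iff, mem_iInter]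
    constructor
    · rintro ⟨p, hp, rfl⟩
      exact ⟨⟨p, rfl⟩, fun H => ⟨p, mem_iInter₂.1 hp H H.2, rfl⟩⟩
    · rintro ⟨⟨p, rfl⟩, h⟩
      refine ⟨p, mem_iInter₂.2 fun H hH => ?_, rfl⟩
      exact I.coordExt_injective.mem_set_image.1 (h ⟨H, hH⟩)
  rw [this]
  exact I.typeDefinable_range_coordExt.inter (.iInter fun H => H.2.2)

/-- No bound on the index of `comp00` is used. Each member of the defining family projects onto `G`,
the family is closed under finite intersections, and saturation over `B` and `g` yields a common
lift of `g`. -/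
theorem map_proj_comp00_eq_top (hN : IsMonster L N κ) (hC : C.Finite)
    (hG : comp00 L κ C I.coordG = ⊤) : (comp00 L κ C I.coordExt).map I.proj = ⊤ := by
  classical
  let 𝓗 : Set (Subgroup I.Ext) := {H | #(I.Ext ⧸ H) < κ ∧
    TypeDefinable L C (I.coordExt '' (H : Set I.Ext))}
  have inf_mem : ∀ s : Finset 𝓗, (s.inf fun H => (H : Subgroup I.Ext)) ∈ 𝓗 := by
    intro s
    induction s using Finset.induction with
    | empty =>
      refine ⟨?_, by simpa using I.typeDefinable_range_coordExt⟩
      have : Subsingleton (I.Ext ⧸ (⊤ : Subgroup I.Ext)) :=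
        QuotientGroup.subsingleton_quotient_top
      rw [Finset.inf_empty]
      exact (le_one_iff_subsingleton.2 this).trans_lt (one_lt_aleph0.trans hN.aleph0_lt)
    | insert H s _ ih =>
      rw [Finset.inf_insert]
      refine ⟨mk_quotient_inf_lt hN.aleph0_lt.le H.2.1 ih.1, ?_⟩
      rw [Subgroup.coe_inf, image_inter I.coordExt_injective]
      exact H.2.2.inter ih.2
  rw [eq_top_iff]
  intro g _
  obtain ⟨u, hu⟩ := hN.exists_mem (C := C ∪ range (I.coordG g)) (hC.union (finite_range _))
    (fun H : 𝓗 => {u : Fin k → N | Sum.elim u (I.coordG g) ∈ I.coordExt '' (H : Set I.Ext)})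
    (fun H => (H.2.2.mono subset_union_left).slice fun i => Or.inr ⟨i, rfl⟩) (by
      intro s
      obtain ⟨p, hp, rfl⟩ : g ∈ Subgroup.map I.proj _ :=
        I.map_proj_eq_top hN hC hG (inf_mem s).2 (inf_mem s).1 ▸ Subgroup.mem_top g
      exact ⟨I.coordA p.a, fun H hH => ⟨p, Finset.inf_le (f := fun H : 𝓗 => (H : Subgroup I.Ext)) hH hp,
        rfl⟩⟩)
  -- The member `⊤` of the family guarantees that the tuple `u` really is an element of `A`.
  have htop : (⊤ : Subgroup I.Ext) ∈ 𝓗 := by simpa using inf_mem ∅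
  obtain ⟨⟨a, g'⟩, -, h⟩ := hu ⟨⊤, htop⟩
  have hg' : g' = g := I.coordG_injective (funext fun i => congrFun h (Sum.inr i))
  refine ⟨⟨a, g⟩, ?_, rfl⟩
  simp only [comp00, Subgroup.coe_sInf, mem_iInter, SetLike.mem_coe]
  intro H hH
  rw [hg'] at h
  have hm := hu ⟨H, hH⟩
  rw [mem_ofPred_eq, ← h] at hm
  exact I.coordExt_injective.mem_set_image.1 hm

end Interp

end Extension

/-! ### The elementary extension -/

section Star

variable {L : FirstOrder.Language.{u, v}} {M : Type w} {N : Type w'} [L.Structure M] [L.Structure N]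

/-- A formula over `b` isolating `y` in `M` still has `j y` as its only solution in `N`, and `σ (j
y)` is a solution. -/
theorem apply_eq_of_mem_dcl (j : M ↪ₑ[L] N) {r : ℕ} {b : Fin r → M} {y : M}
    (hy : y ∈ dcl L (range b)) {σ : N ≃[L] N} (hσ : ∀ c ∈ range (j ∘ b), σ c = c) :
    σ (j y) = j y := by
  obtain ⟨φ, hφ⟩ := definable_iff_exists_formula_sum.1 (show (range b).Definable L _ from hy)
  choose f hf using fun c : range b => c.2
  let θ : L.Formula (Fin r ⊕ Fin 1) := φ.relabel (Sum.map f id)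
  have hθ : ∀ x : Fin 1 → M, θ.Realize (Sum.elim b x) ↔ x 0 = y := by
    intro x
    have h : x 0 = y ↔ φ.Realize (Sum.elim (fun c : range b => (c : M)) x) := Set.ext_iff.1 hφ x
    rw [h, Formula.realize_relabel, Sum.elim_comp_map]
    simp only [Function.comp_def, hf, id]
  let ψ : L.Formula ((Fin r ⊕ Fin 1) ⊕ Fin 1) :=
    (θ.relabel (Sum.map Sum.inl id)).imp
      (Term.equal (Term.var (Sum.inr 0)) (Term.var (Sum.inl (Sum.inr 0))))
  have key := forall_transfer j (Sum.elim b fun _ => y) ψ (by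
    intro v
    simp only [ψ, Formula.realize_imp, Formula.realize_relabel, Sum.elim_comp_map,
      Sum.elim_comp_inl, Function.comp_id, hθ, Formula.realize_equal, Term.realize_var,
      Sum.elim_inr, Sum.elim_inl]
    exact id) (fun _ => σ (j y))
  simp only [ψ, Formula.realize_imp, Formula.realize_relabel, Sum.elim_comp_map,
    Function.comp_id, Formula.realize_equal, Term.realize_var, Function.comp_apply,
    Sum.elim_inr, Sum.elim_inl] at key
  apply key
  have h := (hθ fun _ => y).2 rfl
  rw [← j.map_formula, ← StrongHomClass.realize_formula σ] at h
  convert h using 1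
  funext s
  rcases s with s | s
  · exact (hσ _ ⟨s, rfl⟩).symm
  · rfl

variable {m k r : ℕ} {D : Formulas L m k r} {b : Fin r → M}

namespace Interp

variable (I : Interp D M b) (j : M ↪ₑ[L] N)

/-- The inclusion `G → G*` given by an elementary embedding. -/
def starG (g : I.G) : (I.star j).G := ⟨j ∘ g.1, (j.map_formula D.grp g.1).2 g.2⟩

theorem toStar_add (a c : I.A) : I.toStar j (a + c) = I.toStar j a + I.toStar j c :=
  (((I.star j).add_iff _ _ _).1 (holds₃_map j D.add _ _ _ ((I.holds_add a c _).2 rfl))).symm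

theorem starG_mul (g h : I.G) : I.starG j (g * h) = I.starG j g * I.starG j h :=
  (((I.star j).mul_iff _ _ _).1 (holds₃_map j D.mul _ _ _ ((I.holds_mul g h _).2 rfl))).symm

theorem starG_one : I.starG j 1 = 1 := by
  have h := I.starG_mul j 1 1
  rw [mul_one] at h
  exact left_eq_mul.1 h

theorem toStar_smul (g : I.G) (a : I.A) : I.toStar j (g • a) = I.starG j g • I.toStar j a :=
  (((I.star j).act_iff _ _ _).1 (holds₃_map j D.act _ _ _ ((I.act_iff g a _).2 rfl))).symm

theorem toStar_coc (x y : I.G) :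
    I.toStar j (I.coc x y) = (I.star j).coc (I.starG j x) (I.starG j y) := by
  refine (((I.star j).coc_iff _ _ _).1 ?_).symm
  have h := (I.coc_iff x y _).2 rfl
  unfold Holds₄ at h ⊢
  rw [← j.map_formula] at h
  simp only [Sum.comp_elim] at h
  exact h

theorem toStar_injective : Function.Injective (I.toStar j) := fun _ _ h =>
  Subtype.ext (j.injective.comp_left (congrArg Subtype.val h))

/-- The inclusion `A → A*` as a homomorphism. -/
noncomputable def toStarHom : I.A →+ (I.star j).A := AddMonoidHom.mk' (I.toStar j) (I.toStar_add j)

/-- That `h` takes one of finitely many listed values is a first-order statement with those values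
as parameters, so `h*` takes no new ones. -/
theorem exists_coc_eq (hfin : (range fun p : I.G × I.G => I.coc p.1 p.2).Finite)
    (x y : (I.star j).G) : ∃ x' y' : I.G, (I.star j).coc x y = I.toStar j (I.coc x' y') := by
  obtain ⟨n, c, -, hc⟩ := hfin.fin_param
  let ψ : L.Formula ((Fin r ⊕ Fin n × Fin k) ⊕ (Fin m ⊕ Fin m ⊕ Fin k)) :=
    (D.grp.relabel fun i => Sum.inr (Sum.inl i)).imp
      ((D.grp.relabel fun i => Sum.inr (Sum.inr (Sum.inl i))).imp
        ((D.ab.relabel fun i => Sum.inr (Sum.inr (Sum.inr i))).imp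
          ((D.coc.relabel (Sum.map Sum.inl id)).imp
            (Formula.iSup fun p : Fin n => Formula.iInf fun i : Fin k =>
              Term.equal (Term.var (Sum.inr (Sum.inr (Sum.inr i))))
                (Term.var (Sum.inl (Sum.inr (p, i))))))))
  have key := forall_transfer j (Sum.elim b fun p => I.coordA (c p.1) p.2) ψ (by
    intro v
    simp only [ψ, Formula.realize_imp, Formula.realize_relabel, Formula.realize_iSup,
      Formula.realize_iInf, Formula.realize_equal, Term.realize_var, Sum.elim_inr, Sum.elim_inl,
      Function.comp_def]
    intro hx hy hz h
    have h' : I.coc ⟨_, hx⟩ ⟨_, hy⟩ = ⟨_, hz⟩ := (I.coc_iff ⟨_, hx⟩ ⟨_, hy⟩ ⟨_, hz⟩).1 (by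
      convert h using 1
      unfold Holds₄
      congr! 1
      funext s
      rcases s with s | s | s | s <;> rfl)
    obtain ⟨p, hp⟩ : I.coc ⟨_, hx⟩ ⟨_, hy⟩ ∈ range c := hc ▸ ⟨(_, _), rfl⟩
    refine ⟨p, fun i => ?_⟩
    rw [hp, h']
    rfl)
    (Sum.elim ((I.star j).coordG x)
      (Sum.elim ((I.star j).coordG y) ((I.star j).coordA ((I.star j).coc x y))))
  simp only [ψ, Formula.realize_imp, Formula.realize_relabel, Formula.realize_iSup,
      Formula.realize_iInf, Formula.realize_equal, Term.realize_var, Sum.elim_inr, Sum.elim_inl,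
      Function.comp_def] at key
  obtain ⟨p, hp⟩ := key x.2 y.2 ((I.star j).coc x y).2 (by
    have h := ((I.star j).coc_iff x y _).2 rfl
    unfold Holds₄ at h
    convert h using 1
    funext s
    rcases s with s | s | s | s <;> rfl)
  obtain ⟨⟨x', y'⟩, h⟩ : c p ∈ range fun p : I.G × I.G => I.coc p.1 p.2 := hc ▸ mem_range_self p
  refine ⟨x', y', (I.star j).coordA_injective (funext fun i => ?_)⟩
  rw [hp i, ← h]
  rfl

theorem map_A₀ (hfin : (range fun p : I.G × I.G => I.coc p.1 p.2).Finite) :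
    I.A₀.map (I.toStarHom j) = (I.star j).A₀ := by
  rw [A₀, AddMonoidHom.map_closure, A₀]
  congr 1
  ext a
  constructor
  · rintro ⟨_, ⟨⟨x, y⟩, rfl⟩, rfl⟩
    exact ⟨(_, _), (I.toStar_coc j x y).symm⟩
  · rintro ⟨⟨x, y⟩, rfl⟩
    obtain ⟨x', y', h⟩ := I.exists_coc_eq j hfin x y
    exact ⟨_, ⟨(x', y'), rfl⟩, h.symm⟩

theorem invariant_A₀ (hfin : (range fun p : I.G × I.G => I.coc p.1 p.2).Finite)
    (hdcl : ∀ (x y : I.G) (i : Fin k), I.coordA (I.coc x y) i ∈ dcl L (range b)) :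
    Invariant L (range (j ∘ b)) ((I.star j).coordA '' ((I.star j).A₀ : Set (I.star j).A)) := by
  rw [invariant_iff]
  intro σ hσ a ha
  -- In fact `A₀` is fixed pointwise: its generators are values of `h`, with coordinates in
  -- `dcl(B)`.
  suffices (I.star j).autA σ a = a by rwa [this]
  let f : (I.star j).A →+ (I.star j).A := AddMonoidHom.mk' _ ((I.star j).autA_add σ)
  refine AddMonoidHom.eqOn_closure (f := f) (g := AddMonoidHom.id _) ?_ ha
  rintro _ ⟨⟨x, y⟩, rfl⟩
  obtain ⟨x', y', h⟩ := I.exists_coc_eq j hfin x y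
  refine (I.star j).coordA_injective (funext fun i => ?_)
  change σ ((I.star j).coordA ((I.star j).coc x y) i) = (I.star j).coordA ((I.star j).coc x y) i
  rw [h]
  exact apply_eq_of_mem_dcl j (hdcl x' y' i) hσ

theorem fg_A₀ (hfin : (range fun p : I.G × I.G => I.coc p.1 p.2).Finite) : AddGroup.FG I.A₀ :=
  (AddGroup.fg_iff_addSubgroup_fg _).2 ((AddSubgroup.fg_iff _).2 ⟨_, rfl, hfin⟩)

/-- If every element of `G` lifts to an element of `H` in `(A₀ + K) × G*`, where `K` contains the
intersection of `H` with `A*`, then the cocycle splits modulo `K`. -/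
theorem exists_splitting (H : Subgroup (I.star j).Ext) {K : AddSubgroup (I.star j).A}
    (hKG : ∀ g : (I.star j).G, ∀ a ∈ K, g • a ∈ K) (hHK : (I.star j).fiber H ≤ K)
    (hlift : ∀ g : I.G, ∃ c : (I.star j).A, (⟨c, I.starG j g⟩ : (I.star j).Ext) ∈ H ∧
      ∃ a : I.A₀, c - I.toStar j a ∈ K) :
    ∃ f : I.G → I.A₀, (∀ x y, I.toStar j
      (f x + I.act₀ x (f y) + I.coc₀ x y - f (x * y) : I.A₀) ∈ K) ∧ I.toStar j (f 1) ∈ K := by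
  choose c hc f hf using hlift
  refine ⟨f, fun x y => ?_, ?_⟩
  · have h1 := H.mul_mem (hc x) (hc y)
    rw [mk_mul, ← starG_mul, ← toStar_coc] at h1
    -- The product of the lifts of `x` and `y`, and the lift of `x * y`, lie over the same element,
    -- so they differ by an element of the fiber.
    have h2 := hHK ((I.star j).sub_mem_fiber h1 (hc (x * y)))
    have h3 : I.toStarHom j (f x + I.act₀ x (f y) + I.coc₀ x y - f (x * y) : I.A₀) =
        (c x + I.starG j x • c y + I.toStar j (I.coc x y) - c (x * y)) - (c x - I.toStar j (f x))
          - I.starG j x • (c y - I.toStar j (f y)) + (c (x * y) - I.toStar j (f (x * y))) := by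
      rw [AddSubgroup.coe_sub, AddSubgroup.coe_add, AddSubgroup.coe_add, map_sub, map_add,
        map_add, smul_sub, ← toStar_smul]
      change I.toStar j (f x) + I.toStar j (x • (f y : I.A)) + I.toStar j (I.coc x y) -
        I.toStar j (f (x * y)) = _
      abel
    change I.toStarHom j _ ∈ K
    rw [h3]
    exact K.add_mem (K.sub_mem (K.sub_mem h2 (hf x)) (hKG _ _ (hf y))) (hf _)
  · have h := hc 1
    rw [starG_one] at h
    have := K.sub_mem (hHK h) (hf 1)
    rwa [sub_sub_cancel] at this

theorem exists_sub_toStar_mem (hfin : (range fun p : I.G × I.G => I.coc p.1 p.2).Finite)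
    {K : AddSubgroup (I.star j).A} {c : (I.star j).A} (hc : c ∈ (I.star j).A₀ ⊔ K) :
    ∃ a : I.A₀, c - I.toStar j a ∈ K := by
  rw [← I.map_A₀ j hfin] at hc
  obtain ⟨_, ⟨a, ha, rfl⟩, w, hw, rfl⟩ := AddSubgroup.mem_sup.1 hc
  refine ⟨⟨a, ha⟩, ?_⟩
  change I.toStarHom j a + w - I.toStarHom j a ∈ K
  rwa [add_sub_cancel_left]

theorem smul_mem_sup {N : Type*} [L.Structure N] {b : Fin r → N} (I : Interp D N b)
    {K : AddSubgroup I.A} (hK : ∀ g : I.G, ∀ a ∈ K, g • a ∈ K) (g : I.G) :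
    ∀ a ∈ I.A₀ ⊔ K, g • a ∈ I.A₀ ⊔ K := by
  intro a ha
  obtain ⟨u, hu, v, hv, rfl⟩ := AddSubgroup.mem_sup.1 ha
  rw [smul_add]
  exact AddSubgroup.add_mem_sup (I.smul_mem_A₀ g hu) (hK g v hv)

end Interp

end Star

/-! ### The two parts of the theorem -/

section Main

variable {L : FirstOrder.Language.{u, v}} {M : Type w} {N : Type w'} [L.Structure M] [L.Structure N]
variable {m k r : ℕ} {D : Formulas L m k r} {b : Fin r → M} {κ : Cardinal.{w'}}

/-- The first part: the fiber of `comp00` over `1` lies in `A₁`, so `comp00 = comp000` would split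
`h`. -/
theorem comp000_ne_comp00 (S : Situation0 D M b) (hN : IsMonster L N κ) (j : M ↪ₑ[L] N)
    (A₁ : AddSubgroup (S.star j).A) (hA₁_index : #((S.star j).A ⧸ A₁) < κ)
    (hA₁_def : TypeDefinable L (range (j ∘ b)) ((S.star j).coordA '' (A₁ : Set (S.star j).A)))
    (hA₁_inv : ∀ g : (S.star j).G, ∀ a ∈ A₁, g • a ∈ A₁)
    (h_nonsplit : ¬ IsSplit S.act₀ S.coc₀)
    (h_inter : ∀ a : S.A₀, S.toStar j a ∈ A₁ → a = 0)
    (h_torsionFree : IsAddTorsionFree S.A₀)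
    (h_conn : comp00 L κ (range (j ∘ b)) (S.star j).coordG = ⊤) :
    comp000 L κ (range (j ∘ b)) (S.star j).coordExt ≠
      comp00 L κ (range (j ∘ b)) (S.star j).coordExt := by
  intro heq
  let I := S.star j
  have hfin : (range fun p : S.G × S.G => S.coc p.1 p.2).Finite := S.finite_range
  have hC : (range (j ∘ b)).Finite := finite_range _
  let H := comp00 L κ (range (j ∘ b)) I.coordExt
  have hH : TypeDefinable L (range (j ∘ b)) (I.coordExt '' (H : Set I.Ext)) :=
    I.typeDefinable_comp00
  -- This is where the assumed equality enters: as the invariant component, `H` lies in a box that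
  -- is only invariant.
  have hbox : H ≤ I.box (I.A₀ ⊔ A₁) (fun g => I.smul_mem_sup hA₁_inv g) le_sup_left := by
    change comp00 L κ (range (j ∘ b)) I.coordExt ≤ _
    rw [← heq]
    refine sInf_le ⟨(I.mk_quotient_box_le _ _ le_sup_right).trans_lt hA₁_index, ?_⟩
    exact I.invariant_box _ _ (I.invariant_sup (S.invariant_A₀ j hfin S.range_dcl)
      hA₁_def.invariant)
  have hfg := S.fg_A₀ hfin
  have hdiv : ∀ p : ℤ, 1 < p → ∀ a ∈ I.A₀, (∀ n : ℕ, ∃ c ∈ I.A₀, a = p ^ n • c) → a = 0 := by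
    intro p hp a ha h
    rw [← S.map_A₀ j hfin] at ha h
    obtain ⟨a, ha, rfl⟩ := ha
    have : (⟨a, ha⟩ : S.A₀) = 0 := eq_zero_of_forall_pow_smul hp fun n => by
      obtain ⟨_, ⟨c, hc, rfl⟩, h⟩ := h n
      rw [← map_zsmul] at h
      exact ⟨⟨c, hc⟩, Subtype.ext (S.toStar_injective j h)⟩
    rw [show a = 0 from congrArg Subtype.val this, map_zero]
  have hfiber : I.fiber H ≤ A₁ := by
    refine I.le_of_le_sup hN hC (I.typeDefinable_fiber hN hC hH) hA₁_def ?_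
      (hdiv 2 (by norm_num)) (hdiv 3 (by norm_num)) (fun a ha => hbox ha)
    intro a ha ha₁
    rw [← S.map_A₀ j hfin] at ha
    obtain ⟨a, ha, rfl⟩ := ha
    rw [show a = 0 from congrArg Subtype.val (h_inter ⟨a, ha⟩ ha₁), map_zero]
  obtain ⟨f, hf, hf1⟩ := S.exists_splitting j H hA₁_inv hfiber (by
    intro g
    obtain ⟨⟨c, g'⟩, hc, rfl : g' = _⟩ : S.starG j g ∈ H.map I.proj :=
      (I.map_proj_comp00_eq_top hN hC h_conn).symm ▸ Subgroup.mem_top _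
    exact ⟨c, hc, S.exists_sub_toStar_mem j hfin (hbox hc)⟩)
  -- The lifts give `f(x) + x · f(y) + h(x, y) = f(xy)`, so it is `-f` that splits `h`.
  refine h_nonsplit ⟨-f, fun x y => ?_, ?_⟩
  · have h := h_inter _ (hf x y)
    simp only [Pi.neg_apply, map_neg]
    rw [← sub_eq_zero, ← h]
    abel
  · rw [Pi.neg_apply, h_inter _ hf1, neg_zero]

/-- The second part: the fiber over `1` of a type-definable subgroup of bounded index contains `A₀`
by strong non-splitness, hence is all of `A*` by denseness. -/
theorem comp00_eq_top (S : Situation0 D M b) (hN : IsMonster L N κ) (j : M ↪ₑ[L] N)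
    (h_conn : comp00 L κ (range (j ∘ b)) (S.star j).coordG = ⊤)
    (h_conn' : comp000 L κ (range (j ∘ b)) (S.star j).coordG = ⊤)
    (h_nonsplit : ∀ (Z : AddSubgroup S.A₀) (hZ : ∀ g : S.G, Z ≤ Z.comap (S.act₀ g)), Z ≠ ⊤ →
      ¬ IsSplit (S.actQuot Z hZ) (S.cocQuot Z))
    (h_dense : ∀ H : AddSubgroup (S.star j).A,
      TypeDefinable L (range (j ∘ b)) ((S.star j).coordA '' (H : Set (S.star j).A)) →
      #((S.star j).A ⧸ H) < κ → (∀ a : S.A₀, S.toStar j a ∈ H) → H = ⊤) :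
    comp00 L κ (range (j ∘ b)) (S.star j).coordExt = ⊤ := by
  let I := S.star j
  have hfin : (range fun p : S.G × S.G => S.coc p.1 p.2).Finite := S.finite_range
  have hC : (range (j ∘ b)).Finite := finite_range _
  refine sInf_eq_top.2 fun H ⟨hHi, hH⟩ => ?_
  have hproj : H.map I.proj = ⊤ := I.map_proj_eq_top hN hC h_conn hH hHi
  have hKG : ∀ g : I.G, ∀ a ∈ I.fiber H, g • a ∈ I.fiber H := fun g _ => I.smul_mem_fiber hproj g
  have hK : TypeDefinable L (range (j ∘ b)) (I.coordA '' (I.fiber H : Set I.A)) :=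
    I.typeDefinable_fiber hN hC hH
  have hKi : #(I.A ⧸ I.fiber H) < κ := (I.mk_quotient_fiber_le H).trans_lt hHi
  let E := I.box (I.A₀ ⊔ I.fiber H) (fun g => I.smul_mem_sup hKG g) le_sup_left
  have hE : #(I.Ext ⧸ E) < κ := (I.mk_quotient_box_le _ _ le_sup_right).trans_lt hKi
  -- Here `(G*)^000 = G*` is needed: `A₀ + K` is known only to be invariant, so the same holds for
  -- `H ⊓ E` and its projection.
  have hprojE : (H ⊓ E).map I.proj = ⊤ := by
    refine sInf_eq_top.1 h_conn' _ ⟨(mk_quotient_le_of_comap_le I.proj I.proj_surjective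
      (Subgroup.le_comap_map _ _)).trans_lt (mk_quotient_inf_lt hN.aleph0_lt.le hHi hE), ?_⟩
    refine I.invariant_map_proj ?_
    have hEinv := I.invariant_box (fun g => I.smul_mem_sup hKG g) le_sup_left
      (I.invariant_sup (S.invariant_A₀ j hfin S.range_dcl) hK.invariant)
    rw [Subgroup.coe_inf, image_inter I.coordExt_injective]
    exact fun σ hσ x hx => ⟨hH.invariant σ hσ x hx.1, hEinv σ hσ x hx.2⟩
  obtain ⟨f, hf, hf1⟩ := S.exists_splitting j H hKG le_rfl (by
    intro g
    obtain ⟨⟨c, g'⟩, hc, rfl : g' = _⟩ : S.starG j g ∈ (H ⊓ E).map I.proj :=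
      hprojE ▸ Subgroup.mem_top _
    exact ⟨c, hc.1, S.exists_sub_toStar_mem j hfin hc.2⟩)
  -- `Z` is `A₀ ∩ K` pulled back to `M`; it is stable under `G` because the fiber is stable under
  -- `G*`.
  let Z : AddSubgroup S.A₀ := (I.fiber H).comap ((S.toStarHom j).comp S.A₀.subtype)
  have hZ : ∀ g : S.G, Z ≤ Z.comap (S.act₀ g) := by
    intro g a ha
    have := hKG (S.starG j g) _ ha
    change S.toStar j (g • (a : S.A)) ∈ I.fiber H
    rw [S.toStar_smul]
    exact this
  have hZtop : Z = ⊤ := by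
    by_contra hne
    refine h_nonsplit Z hZ hne ⟨fun g => -QuotientAddGroup.mk (f g), fun x y => ?_, ?_⟩
    · have h : (QuotientAddGroup.mk (f x + S.act₀ x (f y) + S.coc₀ x y - f (x * y)) : S.A₀ ⧸ Z) = 0 :=
        (QuotientAddGroup.eq_zero_iff _).2 (hf x y)
      have h' : S.actQuot Z hZ x (QuotientAddGroup.mk (f y)) =
        QuotientAddGroup.mk (S.act₀ x (f y)) := rfl
      simp only [map_neg]
      rw [h', ← sub_eq_zero, ← h, Interp.cocQuot]
      simp only [QuotientAddGroup.mk_add, QuotientAddGroup.mk_sub]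
      abel
    · rw [neg_eq_zero]
      exact (QuotientAddGroup.eq_zero_iff _).2 hf1
  have hfiber : I.fiber H = ⊤ := h_dense _ hK hKi fun a =>
    show a ∈ Z from hZtop ▸ AddSubgroup.mem_top a
  rw [eq_top_iff]
  rintro ⟨a, g⟩ -
  obtain ⟨⟨c, g⟩, hc, rfl⟩ : g ∈ H.map I.proj := hproj ▸ Subgroup.mem_top _
  -- As `H` contains all of `A*`, any lift `(c, g)` in `H` can be corrected to `(a, g)`.
  have ha : (⟨a - c, 1⟩ : I.Ext) ∈ H := Interp.mem_fiber.1 (hfiber ▸ AddSubgroup.mem_top _)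
  have := H.mul_mem ha hc
  rwa [I.mk_one_mul, sub_add_cancel] at this

end Main

end ConnComp

theorem mainTheorem2 {L : FirstOrder.Language.{u, v}} {M : Type w} {N : Type w'}
    [L.Structure M] [L.Structure N] {m k r : ℕ}
    -- `G`, `A`, the action of `G` on `A` and the cocycle `h`, in the structure `M`
    (D : Formulas L m k r) (b : Fin r → M) (S : Situation0 D M b)
    -- a monster model `N` elementarily extending `M`; `S.star j` is the interpretation in `N`
    (κ : Cardinal.{w'}) (hN : IsMonster L N κ) (j : M ↪ₑ[L] N)
    -- a bounded index subgroup of `A*`, type-definable over `B` and invariant under `G*`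
    (A₁ : AddSubgroup (S.star j).A)
    (hA₁_index : Cardinal.mk ((S.star j).A ⧸ A₁) < κ)
    (hA₁_def : TypeDefinable L (range (j ∘ b)) ((S.star j).coordA '' (A₁ : Set (S.star j).A)))
    (hA₁_inv : ∀ g : (S.star j).G, ∀ a ∈ A₁, g • a ∈ A₁)
    -- (1) `h : G × G → A₀` is non-split
    (h_nonsplit : ¬ IsSplit S.act₀ S.coc₀)
    -- (2) `A₁ ∩ A₀` is trivial and `A₀` is torsion free
    (h_inter : ∀ a : S.A₀, S.toStar j a ∈ A₁ → a = 0)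
    (h_torsionFree : IsAddTorsionFree S.A₀)
    -- (3) `(G*)^{00}_B = G*`
    (h_conn : comp00 L κ (range (j ∘ b)) (S.star j).coordG = ⊤) :
    comp000 L κ (range (j ∘ b)) (S.star j).coordExt ≠
      comp00 L κ (range (j ∘ b)) (S.star j).coordExt ∧
    (comp000 L κ (range (j ∘ b)) (S.star j).coordG = ⊤ →
      -- (4) strong non-splitness of `h`
      (∀ (Z : AddSubgroup S.A₀) (hZ : ∀ g : S.G, Z ≤ Z.comap (S.act₀ g)), Z ≠ ⊤ →
        ¬ IsSplit (S.actQuot Z hZ) (S.cocQuot Z)) →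
      -- (5) denseness of `A₀` in `A*`
      (∀ H : AddSubgroup (S.star j).A,
        TypeDefinable L (range (j ∘ b)) ((S.star j).coordA '' (H : Set (S.star j).A)) →
        Cardinal.mk ((S.star j).A ⧸ H) < κ →
        (∀ a : S.A₀, S.toStar j a ∈ H) → H = ⊤) →
      comp00 L κ (range (j ∘ b)) (S.star j).coordExt = ⊤) :=
  ⟨comp000_ne_comp00 S hN j A₁ hA₁_index hA₁_def hA₁_inv h_nonsplit h_inter h_torsionFree h_conn,
    comp00_eq_top S hN j h_conn⟩
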